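/- All graphs are finite and simple. A set $S$ of vertices of $G$ is dominating if every vertex of $G$ is in $S$ or is adjacent to a vertex of $S$; a dominating set is minimal if it contains no other dominating set. $G$ is well-dominated if all its minimal dominating sets have the same cardinality, and well-covered if all its maximal (with respect to inclusion) independent sets have the same cardinality. (a) Let $G$ be a connected graph that has no subgraph (induced or not) isomorphic to the cycle $C_4$ or to the cycle $C_5$. Then $G$ is well-dominated if and only if $G$ is well-covered. (b) There are a Turing machine and a polynomial $p$ such that, for every $n\ge 0$ and every graph $G$ (connected or not) with vertex set $\{0,\dots,n-1\}$ and with no subgraph (induced or not) isomorphic to $C_4$ or $C_5$, the machine, given the adjacency matrix of $G$ written row by row with end-of-row markers, halts after at most $p(n(n+1))$ steps, where $n(n+1)$ is the length of the input, and correctly answers whether $G$ is well-dominated. -/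

import Mathlib

namespace SimpleGraph

variable {V : Type*} (G : SimpleGraph V)

/-- `S` is dominating: every vertex is in `S` or has a neighbour in `S`. -/
def IsDominating (S : Finset V) : Prop :=
  ∀ v : V, v ∈ S ∨ ∃ u ∈ S, G.Adj u v

/-- `S` is a minimal dominating set: it is dominating, and contains no other dominating set. -/
def IsMinimalDominating (S : Finset V) : Prop :=
  Minimal G.IsDominating S

/-- `S` is a maximal independent set: it is independent, and is contained in no other
independent set. -/
def IsMaximalIndependent (S : Finset V) : Prop :=
  Maximal (fun T : Finset V => G.IsIndepSet (T : Set V)) S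

/-- All minimal dominating sets have the same cardinality. -/
def WellDominated : Prop :=
  ∀ S T : Finset V, G.IsMinimalDominating S → G.IsMinimalDominating T → S.card = T.card

/-- All maximal independent sets have the same cardinality. -/
def WellCovered : Prop :=
  ∀ S T : Finset V, G.IsMaximalIndependent S → G.IsMaximalIndependent T → S.card = T.card

/-- No subgraph, induced or not, is a cycle on 4 or on 5 vertices. -/
def NoC4C5 : Prop :=
  (cycleGraph 4).Free G ∧ (cycleGraph 5).Free G

end SimpleGraph

/-- The inputs of the recognition problem: graphs on `{0, …, n - 1}`, for any `n`,
with no 4-cycle and no 5-cycle (connected or not). -/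
def GraphNoC4C5 : Type :=
  {Γ : (n : ℕ) × SimpleGraph (Fin n) // Γ.2.NoC4C5}

open Classical in
/-- The adjacency matrix of a graph, written row by row: the entries `some true` and `some false`
are the matrix bits and `none` marks the end of a row. A graph on `n` vertices is encoded by
a word of length `n * (n + 1)` over a three-letter alphabet. -/
noncomputable def encodeGraph {n : ℕ} (G : SimpleGraph (Fin n)) : List (Option Bool) :=
  (List.finRange n).flatMap fun i =>
    ((List.finRange n).map fun j => some (decide (G.Adj i j))) ++ [none]

open Classical in
/-- A multi-stack Turing machine decides, in a number of steps polynomial in the length of the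
encoded input, whether an input graph without 4-cycles and 5-cycles is well-dominated. -/
def WellDominatedRecognizableInPolyTime : Prop :=
  Nonempty (Turing.TM2ComputableInPolyTime
    (fun Γ : GraphNoC4C5 => encodeGraph Γ.1.2) Computability.encodeBool
    (fun Γ : GraphNoC4C5 => decide Γ.1.2.WellDominated))

/-! Call the closed neighbourhood of a simplicial vertex a simplex. Everything rests on a structure
theorem: a finite graph without 4-cycles and 5-cycles is well-dominated iff it is well-covered iff
it satisfies `IsSimplexPartitioned`, that is, every vertex lies in a simplex or in a component
isomorphic to C₇ or T₁₀, and simplices that meet coincide.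

Well-dominated graphs are well-covered because maximal independent sets are minimal dominating sets.
Conversely, the structure gives a partition of the vertices into simplices and exceptional
components. A minimal dominating set meets each simplex in exactly one vertex, each C₇ in three
vertices and each T₁₀ in four, so its size is determined.

That well-covered graphs have the structure is proved by exchange: trading one vertex of a maximal
independent set for two is impossible. This makes meeting simplices coincide
(`WellCovered.simplex_unique`) and shows that the vertices outside all simplices fill whole
components (`not_inSimplex_of_adj`). In such a component, if removing any N[w] puts all remaining
vertices into simplices, the component is a 7-cycle (`inExceptional_of_isolate_inSimplex`).
Otherwise some removal leaves a vertex outside all simplices, which by induction is exceptional in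
the smaller graph. It then remains to see that a C₇ or T₁₀ that is a component after the removal of
N[v] was one before, or was a C₇ inside a T₁₀. If not, a neighbour of v is attached to the copy.
Comparing independent sets restricts the possible attachments to a finite problem: nothing can be
attached to T₁₀ (`IsAttachment.not_adj_tripod`), and C₇ can only be completed to T₁₀
(`IsAttachment.isClosedCopy_tripod`).

For recognition, the structure is expressed by one fixed first-order sentence. Nested loops over the
vertices evaluate such a sentence in polynomial time (`Fml.exec_prog`); they are written as
structured stack programs and compiled to a multi-stack machine. -/

namespace SimpleGraph

variable {V : Type*} {G : SimpleGraph V}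

/-! ### Short cycles, maximal independent sets and simplices -/

/-- Elementwise form of having neither 4-cycles nor 5-cycles. -/
structure NoShortCycle (G : SimpleGraph V) : Prop where
  four : ∀ {a b c d : V}, G.Adj a b → G.Adj b c → G.Adj c d → G.Adj d a → a ≠ c → b ≠ d → False
  five : ∀ {a b c d e : V}, G.Adj a b → G.Adj b c → G.Adj c d → G.Adj d e → G.Adj e a →
    a ≠ c → a ≠ d → b ≠ d → b ≠ e → c ≠ e → False

theorem NoC4C5.noShortCycle (h : G.NoC4C5) : G.NoShortCycle where
  four {a b c d} h1 h2 h3 h4 hac hbd := by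
    refine h.1 ⟨⟨⟨![a, b, c, d], ?_⟩, ?_⟩⟩
    · intro i j hij
      fin_cases i <;> fin_cases j <;>
        first
        | exact h1 | exact h2 | exact h3 | exact h4
        | exact h1.symm | exact h2.symm | exact h3.symm | exact h4.symm
        | exact absurd hij (by rw [cycleGraph_adj]; decide)
    · have e1 := h1.ne
      have e2 := h2.ne
      have e3 := h3.ne
      have e4 := h4.ne
      intro i j hij
      fin_cases i <;> fin_cases j <;> first | rfl | (exfalso; simp_all)
  five {a b c d e} h1 h2 h3 h4 h5 hac had hbd hbe hce := by
    refine h.2 ⟨⟨⟨![a, b, c, d, e], ?_⟩, ?_⟩⟩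
    · intro i j hij
      fin_cases i <;> fin_cases j <;>
        first
        | exact h1 | exact h2 | exact h3 | exact h4 | exact h5
        | exact h1.symm | exact h2.symm | exact h3.symm | exact h4.symm | exact h5.symm
        | exact absurd hij (by rw [cycleGraph_adj]; decide)
    · have e1 := h1.ne
      have e2 := h2.ne
      have e3 := h3.ne
      have e4 := h4.ne
      have e5 := h5.ne
      intro i j hij
      fin_cases i <;> fin_cases j <;> first | rfl | (exfalso; simp_all)

theorem NoShortCycle.mono {H : SimpleGraph V} (h : G.NoShortCycle) (hle : H ≤ G) :
    H.NoShortCycle where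
  four h1 h2 h3 h4 := h.four (hle h1) (hle h2) (hle h3) (hle h4)
  five h1 h2 h3 h4 h5 := h.five (hle h1) (hle h2) (hle h3) (hle h4) (hle h5)

theorem isIndepSet_coe_iff {S : Finset V} :
    G.IsIndepSet (S : Set V) ↔ ∀ x ∈ S, ∀ y ∈ S, ¬ G.Adj x y := by
  constructor
  · intro h x hx y hy hxy
    exact h hx hy hxy.ne hxy
  · intro h x hx y hy _
    exact h x hx y hy

theorem isMaximalIndependent_iff {M : Finset V} :
    G.IsMaximalIndependent M ↔
      (∀ x ∈ M, ∀ y ∈ M, ¬ G.Adj x y) ∧ ∀ x, x ∉ M → ∃ y ∈ M, G.Adj y x := by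
  classical
  constructor
  · intro h
    have hi := isIndepSet_coe_iff.1 h.1
    refine ⟨hi, fun x hx => ?_⟩
    by_contra! hno
    refine hx (h.2 (y := insert x M) (isIndepSet_coe_iff.2 ?_) (Finset.subset_insert _ _)
      (Finset.mem_insert_self _ _))
    intro a ha b hb hab
    rcases Finset.mem_insert.1 ha with rfl | ha' <;> rcases Finset.mem_insert.1 hb with rfl | hb'
    · exact hab.ne rfl
    · exact hno b hb' hab.symm
    · exact hno a ha' hab
    · exact hi a ha' b hb' hab
  · rintro ⟨hi, hd⟩
    refine ⟨isIndepSet_coe_iff.2 hi, fun T hT hMT x hx => ?_⟩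
    by_contra hxM
    obtain ⟨y, hy, hyx⟩ := hd x hxM
    exact isIndepSet_coe_iff.1 hT y (hMT hy) x hx hyx

theorem exists_maximalIndependent [Finite V] {I : Finset V} (hI : ∀ x ∈ I, ∀ y ∈ I, ¬ G.Adj x y) :
    ∃ M, I ⊆ M ∧ G.IsMaximalIndependent M := by
  cases nonempty_fintype V
  obtain ⟨M, hM, hmax⟩ := (Set.toFinite {T : Finset V | G.IsIndepSet (T : Set V)}).exists_le_maximal
    (isIndepSet_coe_iff.2 hI : I ∈ {T : Finset V | G.IsIndepSet (T : Set V)})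
  exact ⟨M, hM, hmax⟩

/-- In a well-covered graph a maximal independent set has maximum size. -/
theorem WellCovered.card_le [Finite V] (h : G.WellCovered) {M I : Finset V}
    (hM : G.IsMaximalIndependent M) (hI : ∀ x ∈ I, ∀ y ∈ I, ¬ G.Adj x y) : I.card ≤ M.card := by
  obtain ⟨N, hIN, hN⟩ := exists_maximalIndependent hI
  exact (Finset.card_le_card hIN).trans (h N M hN hM).le

/-- The neighbours of `x` are pairwise adjacent. -/
def IsSimplicial (G : SimpleGraph V) (x : V) : Prop :=
  ∀ y z, G.Adj x y → G.Adj x z → y ≠ z → G.Adj y z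

/-- `v` lies in the closed neighbourhood of a simplicial vertex. -/
def InSimplex (G : SimpleGraph V) (v : V) : Prop :=
  ∃ x, (x = v ∨ G.Adj x v) ∧ G.IsSimplicial x

/-- Two neighbours of `b` other than `a` would both be adjacent to `a` and close a 4-cycle, so there
is at most one. -/
theorem NoShortCycle.isSimplicial_of_subset (h : G.NoShortCycle) {a b : V} (hab : G.Adj a b)
    (hb : ∀ c, G.Adj b c → c = a ∨ G.Adj c a) : G.IsSimplicial b := by
  intro y z hy hz hyz
  rcases hb y hy with rfl | hya
  · rcases hb z hz with rfl | hza
    · exact (hyz rfl).elim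
    · exact hza.symm
  · rcases hb z hz with rfl | hza
    · exact hya
    · exact (h.four hya.symm hy.symm hz hza hab.ne hyz).elim

/-- A neighbour of a vertex outside all simplices has a neighbour at distance two. -/
theorem exists_far_of_not_inSimplex (h : G.NoShortCycle) {v a : V} (hv : ¬ G.InSimplex v)
    (hva : G.Adj v a) : ∃ b, G.Adj a b ∧ b ≠ v ∧ ¬ G.Adj b v := by
  by_contra! hno
  refine hv ⟨a, Or.inr hva.symm, h.isSimplicial_of_subset hva fun c hc => ?_⟩
  by_cases hcv : c = v
  · exact Or.inl hcv
  · exact Or.inr (hno c hc hcv)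

/-- Two simplices of a well-covered graph that share a vertex coincide. -/
theorem WellCovered.simplex_unique [Finite V] (hw : G.WellCovered) {v x y : V}
    (hx : G.IsSimplicial x) (hy : G.IsSimplicial y) (hxv : x = v ∨ G.Adj x v)
    (hyv : y = v ∨ G.Adj y v) : x = y ∨ G.Adj x y := by
  classical
  by_contra! hxy
  have hxv' : G.Adj x v := by
    rcases hxv with rfl | h
    · rcases hyv with rfl | h'
      · exact (hxy.1 rfl).elim
      · exact (hxy.2 h'.symm).elim
    · exact h
  have hyv' : G.Adj y v := by
    rcases hyv with rfl | h
    · exact (hxy.2 hxv').elim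
    · exact h
  -- Exchange argument: the other neighbours of `x` and of `y` are adjacent to `v`, so in a maximal
  -- independent set through `v` this vertex could be replaced by both `x` and `y`.
  obtain ⟨M, hvM, hM⟩ := exists_maximalIndependent (G := G) (I := {v}) (by simp)
  obtain ⟨hi, -⟩ := isMaximalIndependent_iff.1 hM
  have hv : v ∈ M := hvM (Finset.mem_singleton_self v)
  have key : ∀ u, G.IsSimplicial u → G.Adj u v → ∀ z ∈ M.erase v, ¬ G.Adj u z := by
    intro u hu huv z hz huz
    have := Finset.mem_erase.1 hz
    exact hi v hv z this.2 (hu v z huv huz this.1.symm)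
  have hxM : x ∉ M := fun hm => hi x hm v hv hxv'
  have hyM : y ∉ M := fun hm => hi y hm v hv hyv'
  have hle := hw.card_le hM (I := insert x (insert y (M.erase v))) (by
    have e := hxy.2
    have e' : ¬ G.Adj y x := fun t => e t.symm
    intro a ha b hb hab
    simp only [Finset.mem_insert] at ha hb
    rcases ha with rfl | rfl | ha <;> rcases hb with rfl | rfl | hb
    · exact hab.ne rfl
    · exact e hab
    · exact key _ hx hxv' _ hb hab
    · exact e' hab
    · exact hab.ne rfl
    · exact key _ hy hyv' _ hb hab
    · exact key _ hx hxv' _ ha hab.symm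
    · exact key _ hy hyv' _ ha hab.symm
    · exact hi a (Finset.mem_of_mem_erase ha) b (Finset.mem_of_mem_erase hb) hab)
  rw [Finset.card_insert_of_notMem, Finset.card_insert_of_notMem, Finset.card_erase_of_mem hv]
    at hle
  · have := Finset.card_pos.2 ⟨v, hv⟩
    omega
  · exact fun t => hyM (Finset.mem_of_mem_erase t)
  · rw [Finset.mem_insert]
    rintro (t | t)
    · exact hxy.1 t
    · exact hxM (Finset.mem_of_mem_erase t)

/-- In a well-covered graph without short cycles, a vertex outside all simplices has only such
neighbours. -/
theorem not_inSimplex_of_adj [Finite V] (h : G.NoShortCycle) (hw : G.WellCovered) {v a : V}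
    (hv : ¬ G.InSimplex v) (hva : G.Adj v a) : ¬ G.InSimplex a := by
  classical
  cases nonempty_fintype V
  rintro ⟨b, hb, hbs⟩
  have hbv : b ≠ v := by
    rintro rfl
    exact hv ⟨b, Or.inl rfl, hbs⟩
  have hbv' : ¬ G.Adj b v := fun t => hv ⟨b, Or.inr t, hbs⟩
  have hba : G.Adj b a := by
    rcases hb with rfl | hb
    · exact (hbv' hva.symm).elim
    · exact hb
  -- A vertex `g c` in the independent set keeps `c` out of it. With `a` also in the set, `a` is the
  -- only neighbour of `v` there, and the only one of the simplicial vertex `b`, so `a` can be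
  -- exchanged for `v` and `b`. The absence of 4-cycles and 5-cycles makes `insert a T` independent.
  choose! g hg using fun c (hc : G.Adj v c) => exists_far_of_not_inSimplex h hv hc
  set T : Finset V := (Finset.univ.filter fun c => G.Adj v c ∧ c ≠ a ∧ ¬ G.Adj c a).image g with hT
  have hTm : ∀ y ∈ T, ∃ c, G.Adj v c ∧ c ≠ a ∧ ¬ G.Adj c a ∧ g c = y := by
    intro y hy
    simp only [hT, Finset.mem_image, Finset.mem_filter, Finset.mem_univ, true_and] at hy
    obtain ⟨c, ⟨h1, h2, h3⟩, h4⟩ := hy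
    exact ⟨c, h1, h2, h3, h4⟩
  have hTa : ∀ y ∈ T, ¬ G.Adj a y := by
    intro y hy hay
    obtain ⟨c, h1, h2, h3, rfl⟩ := hTm y hy
    exact h.four h1 (hg c h1).1 hay.symm hva.symm (hg c h1).2.1.symm h2
  obtain ⟨M, hTM, hM⟩ := exists_maximalIndependent (G := G) (I := insert a T) (by
    intro x hx y hy hxy
    rcases Finset.mem_insert.1 hx with rfl | hx <;> rcases Finset.mem_insert.1 hy with rfl | hy
    · exact hxy.ne rfl
    · exact hTa _ hy hxy
    · exact hTa _ hx hxy.symm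
    · obtain ⟨c, h1, h2, h3, rfl⟩ := hTm x hx
      obtain ⟨d, h1', h2', h3', rfl⟩ := hTm y hy
      have hcd : c ≠ d := by
        rintro rfl
        exact hxy.ne rfl
      refine h.five h1 (hg c h1).1 hxy (hg d h1').1.symm h1'.symm (hg c h1).2.1.symm
        (hg d h1').2.1.symm ?_ hcd ?_
      · rintro rfl
        exact (hg d h1').2.2 h1.symm
      · intro e
        exact (hg c h1).2.2 (e ▸ h1'.symm))
  obtain ⟨hi, -⟩ := isMaximalIndependent_iff.1 hM
  have haM : a ∈ M := hTM (Finset.mem_insert_self _ _)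
  have hvM : ∀ c ∈ M.erase a, ¬ G.Adj v c := by
    intro c hc hvc
    obtain ⟨hca, hcM⟩ := Finset.mem_erase.1 hc
    have hca' : ¬ G.Adj c a := hi c hcM a haM
    refine hi c hcM (g c) (hTM (Finset.mem_insert_of_mem ?_)) (hg c hvc).1
    exact Finset.mem_image.2 ⟨c, by simp [hvc, hca, hca'], rfl⟩
  have hbM : ∀ c ∈ M.erase a, ¬ G.Adj b c := by
    intro c hc hbc
    obtain ⟨hca, hcM⟩ := Finset.mem_erase.1 hc
    exact hi c hcM a haM (hbs c a hbc hba hca)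
  have hle := hw.card_le hM (I := insert v (insert b (M.erase a))) (by
    have e' : ¬ G.Adj v b := fun t => hbv' t.symm
    intro x hx y hy hxy
    simp only [Finset.mem_insert] at hx hy
    rcases hx with rfl | rfl | hx <;> rcases hy with rfl | rfl | hy
    · exact hxy.ne rfl
    · exact e' hxy
    · exact hvM _ hy hxy
    · exact hbv' hxy
    · exact hxy.ne rfl
    · exact hbM _ hy hxy
    · exact hvM _ hx hxy.symm
    · exact hbM _ hx hxy.symm
    · exact hi x (Finset.mem_of_mem_erase hx) y (Finset.mem_of_mem_erase hy) hxy)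
  rw [Finset.card_insert_of_notMem, Finset.card_insert_of_notMem, Finset.card_erase_of_mem haM]
    at hle
  · have := Finset.card_pos.2 ⟨a, haM⟩
    omega
  · exact fun t => hi b (Finset.mem_of_mem_erase t) a haM hba
  · rw [Finset.mem_insert]
    rintro (t | t)
    · exact hbv t.symm
    · exact hi v (Finset.mem_of_mem_erase t) a haM hva

/-! ### Removal of closed neighbourhoods, and components -/

/-- The closed neighbourhood of a set. -/
def closedNbhd (G : SimpleGraph V) (S : Set V) : Set V :=
  {x | x ∈ S ∨ ∃ s ∈ S, G.Adj s x}

/-- The graph with all edges at the closed neighbourhood of `S` removed. -/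
def isolate (G : SimpleGraph V) (S : Set V) : SimpleGraph V where
  Adj x y := G.Adj x y ∧ x ∉ G.closedNbhd S ∧ y ∉ G.closedNbhd S
  symm := ⟨fun _ _ h => ⟨h.1.symm, h.2.2, h.2.1⟩⟩
  loopless := ⟨fun _ h => h.1.ne rfl⟩

theorem isolate_le (S : Set V) : G.isolate S ≤ G := fun _ _ h => h.1

/-- A maximal independent set of the new graph contains all of N[S], now isolated. Dropping the set
`N` of neighbours of `S` leaves a maximal independent set of `G`, so sizes differ by a constant.
Isolating vertices instead of deleting them keeps the vertex type fixed for the inductions. -/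
theorem WellCovered.isolate [Finite V] (hw : G.WellCovered) {S : Set V}
    (hS : ∀ x ∈ S, ∀ y ∈ S, ¬ G.Adj x y) : (G.isolate S).WellCovered := by
  classical
  cases nonempty_fintype V
  set N : Finset V := Finset.univ.filter fun x => ∃ s ∈ S, G.Adj s x with hN
  have hNm : ∀ x, x ∈ N ↔ ∃ s ∈ S, G.Adj s x := by simp [hN]
  have key : ∀ I, (G.isolate S).IsMaximalIndependent I →
      G.IsMaximalIndependent (I \ N) ∧ I.card = (I \ N).card + N.card := by
    intro I hI
    obtain ⟨hi, hd⟩ := isMaximalIndependent_iff.1 hI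
    have hcl : ∀ x ∈ G.closedNbhd S, x ∈ I := by
      intro x hx
      by_contra hxI
      obtain ⟨y, -, hy⟩ := hd x hxI
      exact hy.2.2 hx
    refine ⟨isMaximalIndependent_iff.2 ⟨?_, ?_⟩, ?_⟩
    · intro x hx y hy hxy
      rw [Finset.mem_sdiff, hNm] at hx hy
      have hxS : x ∉ S := fun t => hy.2 ⟨x, t, hxy⟩
      have hyS : y ∉ S := fun t => hx.2 ⟨y, t, hxy.symm⟩
      refine hi x hx.1 y hy.1 ⟨hxy, ?_, ?_⟩
      · rintro (t | t)
        exacts [hxS t, hx.2 t]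
      · rintro (t | t)
        exacts [hyS t, hy.2 t]
    · intro x hx
      rw [Finset.mem_sdiff, not_and, not_not] at hx
      by_cases hxI : x ∈ I
      · obtain ⟨s, hs, hsx⟩ := (hNm x).1 (hx hxI)
        refine ⟨s, Finset.mem_sdiff.2 ⟨hcl s (Or.inl hs), ?_⟩, hsx⟩
        rw [hNm]
        rintro ⟨t, ht, hts⟩
        exact hS t ht s hs hts
      · obtain ⟨y, hy, hyx⟩ := hd x hxI
        refine ⟨y, Finset.mem_sdiff.2 ⟨hy, ?_⟩, hyx.1⟩
        rw [hNm]
        exact fun t => hyx.2.1 (Or.inr t)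
    · rw [Finset.card_sdiff_add_card_eq_card]
      intro x hx
      exact hcl x (Or.inr ((hNm x).1 hx))
  intro I J hI hJ
  obtain ⟨h1, h2⟩ := key I hI
  obtain ⟨h3, h4⟩ := key J hJ
  rw [h2, h4, hw _ _ h1 h3]

theorem isolate_insert {S : Set V} {s : V} (hs : s ∉ G.closedNbhd S) :
    G.isolate (insert s S) = (G.isolate S).isolate {s} := by
  ext x y
  have key : ∀ z, z ∉ G.closedNbhd (insert s S) ↔
      z ∉ G.closedNbhd S ∧ z ∉ (G.isolate S).closedNbhd {s} := by
    intro z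
    simp only [closedNbhd, isolate, Set.mem_ofPred_eq, Set.mem_insert_iff, Set.mem_singleton_iff,
      exists_eq_or_imp, exists_eq_left, not_or, not_exists, not_and] at hs ⊢
    tauto
  simp only [isolate] at key ⊢
  rw [key, key]
  tauto

/-- `f` embeds `Γ` in `G` as a union of connected components. -/
structure IsClosedCopy {k : ℕ} (G : SimpleGraph V) (Γ : SimpleGraph (Fin k)) (f : Fin k → V) :
    Prop where
  inj : Function.Injective f
  adj_iff : ∀ i j, G.Adj (f i) (f j) ↔ Γ.Adj i j
  closed : ∀ i w, G.Adj (f i) w → ∃ j, f j = w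

end SimpleGraph

/-! ### A copy attached to the neighbours of a vertex -/

namespace SimpleGraph

variable {V : Type*} {G : SimpleGraph V}

/-- The situation around a copy of `Γ` that becomes a union of components when `N[v]` is removed:
`S` is an independent set that leaves of `G` only `v`, the set `A` of neighbours of `v` and the
copy of `Γ`. The last two fields compare independent sets extending `S` with the maximal ones. -/
structure IsAttachment {k : ℕ} (Γ : SimpleGraph (Fin k)) (G : SimpleGraph V) (f : Fin k → V)
    (v : V) (A : Finset V) (S : Finset V) (α : ℕ) : Prop where
  indep : ∀ x ∈ S, ∀ y ∈ S, ¬ G.Adj x y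
  notMem_iff : ∀ x, x ∉ G.closedNbhd (S : Set V) ↔ x = v ∨ x ∈ A ∨ ∃ i, f i = x
  adj : ∀ a ∈ A, G.Adj v a
  ne : ∀ i, f i ≠ v
  not_adj : ∀ i, ¬ G.Adj v (f i)
  inj : Function.Injective f
  adj_iff : ∀ i j, G.Adj (f i) (f j) ↔ Γ.Adj i j
  card_le : ∀ Q ⊆ A, ∀ J : Finset (Fin k), (∀ x ∈ Q, ∀ y ∈ Q, ¬ G.Adj x y) →
    (∀ i ∈ J, ∀ j ∈ J, ¬ Γ.Adj i j) → (∀ a ∈ Q, ∀ i ∈ J, ¬ G.Adj a (f i)) →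
    Q.card + J.card ≤ α + 1
  exists_of_card_lt : ∀ a ∈ A, ∀ J : Finset (Fin k), (∀ i ∈ J, ∀ j ∈ J, ¬ Γ.Adj i j) →
    (∀ i ∈ J, ¬ G.Adj a (f i)) → (∀ i, i ∈ J ∨ G.Adj a (f i) ∨ ∃ j ∈ J, Γ.Adj j i) →
    J.card < α → ∃ b ∈ A, b ≠ a ∧ ¬ G.Adj a b ∧ ∀ i ∈ J, ¬ G.Adj b (f i)

/-- `S` is a maximal independent set among the vertices outside N[v] and outside the copy, chosen so
as to leave `a₀` undominated. Then `S`, `v` and the image of `J₀` form a maximal independent set of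
size |S| + α + 1. No independent set is larger, and a smaller one that dominates all but members of
`A` can be extended by a vertex of `A`. -/
theorem exists_isAttachment [Finite V] (h : G.NoShortCycle) (hw : G.WellCovered) {v : V}
    (hv : ¬ G.InSimplex v) {k : ℕ} {Γ : SimpleGraph (Fin k)} {f : Fin k → V}
    (hf : (G.isolate {v}).IsClosedCopy Γ f) (hΓ : ∀ i, ∃ j, Γ.Adj i j) {α : ℕ}
    {J₀ : Finset (Fin k)} (hJ₀ : Γ.IsMaximalIndependent J₀) (hα : J₀.card = α)
    {a₀ : V} (hva : G.Adj v a₀) :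
    ∃ A S, a₀ ∈ A ∧ IsAttachment Γ G f v A S α := by
  classical
  cases nonempty_fintype V
  have hcl : ∀ x, x ∉ G.closedNbhd {v} ↔ x ≠ v ∧ ¬ G.Adj v x := by
    intro x
    simp [closedNbhd]
  have hfv : ∀ i, f i ≠ v ∧ ¬ G.Adj v (f i) := by
    intro i
    obtain ⟨j, hj⟩ := hΓ i
    exact (hcl _).1 ((hf.adj_iff i j).2 hj).2.1
  have hadj : ∀ i j, G.Adj (f i) (f j) ↔ Γ.Adj i j := by
    intro i j
    rw [← hf.adj_iff]
    exact ⟨fun t => ⟨t, (hcl _).2 (hfv i), (hcl _).2 (hfv j)⟩, fun t => t.1⟩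
  have hclosed : ∀ i x, x ≠ v → ¬ G.Adj v x → G.Adj (f i) x → ∃ j, f j = x := fun i x h1 h2 h3 =>
    hf.closed i x ⟨h3, (hcl _).2 (hfv i), (hcl _).2 ⟨h1, h2⟩⟩
  have ha₀ := not_inSimplex_of_adj h hw hv hva
  -- `W` is what remains after removing `N[v]` and the copy of `Γ`
  set W : Set V := {x | x ≠ v ∧ ¬ G.Adj v x ∧ ∀ i, f i ≠ x} with hW
  have hWf : ∀ x ∈ W, ∀ i, ¬ G.Adj x (f i) := by
    intro x hx i hxi
    obtain ⟨j, hj⟩ := hclosed i x hx.1 hx.2.1 hxi.symm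
    exact hx.2.2 j hj
  have hc : ∀ b, G.Adj a₀ b → b ∈ W → ∃ c, G.Adj b c ∧ c ≠ a₀ ∧ ¬ G.Adj c a₀ :=
    fun b hb _ => exists_far_of_not_inSimplex h ha₀ hb
  -- Putting `g b` into `S` for every neighbour `b` of `a₀` in `W` prevents `b` from entering `S`,
  -- so `a₀` ends up in `A`.
  choose! g hg using hc
  have hgW : ∀ b, G.Adj a₀ b → b ∈ W → g b ∈ W := by
    intro b hab hb
    obtain ⟨h1, h2, h3⟩ := hg b hab hb
    refine ⟨?_, ?_, ?_⟩
    · intro e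
      rw [e] at h1
      exact hb.2.1 h1.symm
    · intro e
      exact h.four hva hab h1 e.symm hb.1.symm h2.symm
    · intro i e
      rw [← e] at h1
      exact hWf b hb i h1
  set S₀ : Finset V := (Finset.univ.filter fun b => G.Adj a₀ b ∧ b ∈ W).image g with hS₀
  have hS₀m : ∀ y ∈ S₀, ∃ b, G.Adj a₀ b ∧ b ∈ W ∧ g b = y := by
    intro y hy
    simp only [hS₀, Finset.mem_image, Finset.mem_filter, Finset.mem_univ, true_and] at hy
    obtain ⟨c, ⟨h1, h2⟩, h4⟩ := hy
    exact ⟨c, h1, h2, h4⟩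
  have hS₀i : ∀ x ∈ S₀, ∀ y ∈ S₀, ¬ G.Adj x y := by
    intro x hx y hy hxy
    obtain ⟨b, h1, h2, rfl⟩ := hS₀m x hx
    obtain ⟨c, h1', h2', rfl⟩ := hS₀m y hy
    obtain ⟨h3, h4, h5⟩ := hg b h1 h2
    obtain ⟨h3', h4', h5'⟩ := hg c h1' h2'
    refine h.five h1 h3 hxy h3'.symm h1'.symm h4.symm h4'.symm ?_ ?_ ?_
    · intro e
      exact h5' (e ▸ h1.symm)
    · rintro rfl
      exact hxy.ne rfl
    · intro e
      exact h5 (e ▸ h1'.symm)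
  obtain ⟨S, hS₀S, hS⟩ := (Set.toFinite {T : Finset V |
    (∀ x ∈ T, ∀ y ∈ T, ¬ G.Adj x y) ∧ ∀ x ∈ T, x ∈ W}).exists_le_maximal
    (show S₀ ∈ {T : Finset V | (∀ x ∈ T, ∀ y ∈ T, ¬ G.Adj x y) ∧ ∀ x ∈ T, x ∈ W} from
      ⟨hS₀i, fun x hx => by
        obtain ⟨b, h1, h2, rfl⟩ := hS₀m x hx
        exact hgW b h1 h2⟩)
  have hSi : ∀ x ∈ S, ∀ y ∈ S, ¬ G.Adj x y := hS.1.1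
  have hSW : ∀ x ∈ S, x ∈ W := hS.1.2
  have hSd : ∀ x ∈ W, x ∉ S → ∃ s ∈ S, G.Adj s x := by
    intro x hx hxS
    by_contra! hno
    refine hxS (hS.2 (y := insert x S) ⟨?_, ?_⟩ (Finset.subset_insert _ _)
      (Finset.mem_insert_self _ _))
    · intro y hy z hz hyz
      rcases Finset.mem_insert.1 hy with rfl | hy' <;> rcases Finset.mem_insert.1 hz with rfl | hz'
      · exact hyz.ne rfl
      · exact hno z hz' hyz.symm
      · exact hno y hy' hyz
      · exact hSi y hy' z hz' hyz
    · intro y hy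
      rcases Finset.mem_insert.1 hy with rfl | hy'
      exacts [hx, hSW y hy']
  set A : Finset V := Finset.univ.filter fun a => G.Adj v a ∧ a ∉ G.closedNbhd (S : Set V) with hA
  have hAm : ∀ a, a ∈ A ↔ G.Adj v a ∧ a ∉ G.closedNbhd (S : Set V) := by simp [hA]
  have hAS : ∀ a ∈ A, a ∉ S ∧ ∀ s ∈ S, ¬ G.Adj s a := by
    intro a ha
    have := ((hAm a).1 ha).2
    exact ⟨fun t => this (Or.inl t), fun s hs t => this (Or.inr ⟨s, hs, t⟩)⟩
  have hfS : ∀ i, f i ∉ S ∧ ∀ s ∈ S, ¬ G.Adj s (f i) :=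
    fun i => ⟨fun t => (hSW _ t).2.2 i rfl, fun s hs => hWf s (hSW s hs) i⟩
  have hcard : ∀ Q ⊆ A, ∀ J : Finset (Fin k), (S ∪ (Q ∪ J.image f)).card =
      S.card + (Q.card + J.card) := by
    intro Q hQ J
    rw [Finset.card_union_of_disjoint, Finset.card_union_of_disjoint,
      Finset.card_image_of_injective _ hf.inj]
    · rw [Finset.disjoint_left]
      intro a ha hJ
      obtain ⟨j, -, rfl⟩ := Finset.mem_image.1 hJ
      exact (hfv j).2 ((hAm _).1 (hQ ha)).1
    · rw [Finset.disjoint_left]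
      intro a ha hJ
      rcases Finset.mem_union.1 hJ with hJ | hJ
      · exact (hAS a (hQ hJ)).1 ha
      · obtain ⟨j, -, rfl⟩ := Finset.mem_image.1 hJ
        exact (hfS j).1 ha
  have hind : ∀ Q ⊆ A, ∀ J : Finset (Fin k), (∀ x ∈ Q, ∀ y ∈ Q, ¬ G.Adj x y) →
      (∀ i ∈ J, ∀ j ∈ J, ¬ Γ.Adj i j) → (∀ a ∈ Q, ∀ i ∈ J, ¬ G.Adj a (f i)) →
      ∀ x ∈ S ∪ (Q ∪ J.image f), ∀ y ∈ S ∪ (Q ∪ J.image f), ¬ G.Adj x y := by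
    intro Q hQ J hQi hJi hQJ x hx y hy hxy
    simp only [Finset.mem_union, Finset.mem_image] at hx hy
    rcases hx with hx | hx | ⟨i, hi, rfl⟩ <;> rcases hy with hy | hy | ⟨j, hj, rfl⟩
    · exact hSi x hx y hy hxy
    · exact (hAS y (hQ hy)).2 x hx hxy
    · exact (hfS j).2 x hx hxy
    · exact (hAS x (hQ hx)).2 y hy hxy.symm
    · exact hQi x hx y hy hxy
    · exact hQJ x hx j hj hxy
    · exact (hfS i).2 y hy hxy.symm
    · exact hQJ y hy i hi hxy.symm
    · exact hJi i hi j hj ((hadj i j).1 hxy)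
  obtain ⟨hJi, hJd⟩ := isMaximalIndependent_iff.1 hJ₀
  have hvS : v ∉ S := fun t => (hSW v t).1 rfl
  have hM : G.IsMaximalIndependent (insert v (S ∪ (∅ ∪ J₀.image f))) := by
    have hi := hind ∅ (Finset.empty_subset _) J₀ (by simp) hJi (by simp)
    have hvi : ∀ y ∈ S ∪ (∅ ∪ J₀.image f), ¬ G.Adj v y := by
      intro y hy
      simp only [Finset.mem_union, Finset.mem_image, Finset.notMem_empty, false_or] at hy
      rcases hy with hy | ⟨i, -, rfl⟩
      · exact (hSW y hy).2.1
      · exact (hfv i).2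
    refine isMaximalIndependent_iff.2 ⟨?_, ?_⟩
    · intro x hx y hy hxy
      rcases Finset.mem_insert.1 hx with rfl | hx' <;>
        rcases Finset.mem_insert.1 hy with rfl | hy'
      · exact hxy.ne rfl
      · exact hvi y hy' hxy
      · exact hvi x hx' hxy.symm
      · exact hi x hx' y hy' hxy
    · intro x hx
      simp only [Finset.mem_insert, Finset.mem_union, Finset.mem_image, Finset.notMem_empty,
        false_or, not_or, not_exists, not_and] at hx
      by_cases hvx : G.Adj v x
      · exact ⟨v, Finset.mem_insert_self _ _, hvx⟩
      by_cases hxf : ∃ i, f i = x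
      · obtain ⟨i, rfl⟩ := hxf
        obtain ⟨j, hj, hji⟩ := hJd i fun t => hx.2.2 i t rfl
        exact ⟨f j, by simp only [Finset.mem_insert, Finset.mem_union, Finset.mem_image]
                       exact Or.inr (Or.inr (Or.inr ⟨j, hj, rfl⟩)), (hadj j i).2 hji⟩
      · push Not at hxf
        obtain ⟨s, hs, hsx⟩ := hSd x ⟨hx.1, hvx, hxf⟩ hx.2.1
        exact ⟨s, by simp [hs], hsx⟩
  have hMc : (insert v (S ∪ (∅ ∪ J₀.image f))).card = S.card + (α + 1) := by
    rw [Finset.card_insert_of_notMem, hcard ∅ (Finset.empty_subset _), Finset.card_empty, hα]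
    · ring
    · simp only [Finset.mem_union, Finset.mem_image, Finset.notMem_empty, false_or, not_or,
        not_exists, not_and]
      exact ⟨hvS, fun i _ => (hfv i).1⟩
  refine ⟨A, S, ?_, hSi, ?_, fun a ha => ((hAm a).1 ha).1, fun i => (hfv i).1, fun i => (hfv i).2,
    hf.inj, hadj, ?_, ?_⟩
  · refine (hAm a₀).2 ⟨hva, ?_⟩
    rintro (t | ⟨s, hs, hsa⟩)
    · exact (hSW a₀ t).2.1 hva
    · have hsW := hSW s hs
      refine hSi s hs (g s) (hS₀S (Finset.mem_image.2 ⟨s, ?_, rfl⟩)) (hg s hsa.symm hsW).1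
      simp [hsa.symm, hsW]
  · intro x
    constructor
    · intro hx
      by_cases hxv : x = v
      · exact Or.inl hxv
      by_cases hvx : G.Adj v x
      · exact Or.inr (Or.inl ((hAm x).2 ⟨hvx, hx⟩))
      by_contra! hno
      by_cases hxS : x ∈ S
      · exact hx (Or.inl hxS)
      · exact hx (Or.inr (hSd x ⟨hxv, hvx, hno.2.2⟩ hxS))
    · rintro (rfl | hx | ⟨i, rfl⟩)
      · rintro (t | ⟨s, hs, hsx⟩)
        · exact hvS t
        · exact (hSW s hs).2.1 hsx.symm
      · exact ((hAm x).1 hx).2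
      · rintro (t | ⟨s, hs, hsx⟩)
        · exact (hfS i).1 t
        · exact (hfS i).2 s hs hsx
  · intro Q hQ J h1 h2 h3
    have := hw.card_le hM (hind Q hQ J h1 h2 h3)
    rw [hMc, hcard Q hQ] at this
    omega
  · intro a ha J h2 h3 h4 hlt
    by_contra! hno
    have hQ : {a} ⊆ A := by simpa using ha
    have hi := hind {a} hQ J (by simp) h2 (by simpa using h3)
    -- If no `b` were available, `S`, `a` and `J` would form a maximal independent set smaller than
    -- the one through `v`.
    have hM' : G.IsMaximalIndependent (S ∪ ({a} ∪ J.image f)) := by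
      refine isMaximalIndependent_iff.2 ⟨hi, fun x hx => ?_⟩
      by_contra! hx'
      simp only [Finset.mem_union, Finset.mem_image, Finset.mem_singleton, not_or, not_exists,
        not_and] at hx
      have hxS : ∀ s ∈ S, ¬ G.Adj s x := fun s hs => hx' s (by simp [hs])
      have hxa : ¬ G.Adj a x := hx' a (by simp)
      have hxJ : ∀ j ∈ J, ¬ G.Adj (f j) x := fun j hj => hx' (f j) (by
        simp only [Finset.mem_union, Finset.mem_image]
        exact Or.inr (Or.inr ⟨j, hj, rfl⟩))
      by_cases hxf : ∃ i, f i = x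
      · obtain ⟨i, rfl⟩ := hxf
        rcases h4 i with h5 | h5 | ⟨j, hj, hji⟩
        · exact hx.2.2 i h5 rfl
        · exact hxa h5
        · exact hxJ j hj ((hadj j i).2 hji)
      push Not at hxf
      by_cases hxv : x = v
      · exact hxa (hxv ▸ (((hAm a).1 ha).1).symm)
      by_cases hvx : G.Adj v x
      · obtain ⟨i, hi, hxi⟩ := hno x ((hAm x).2 ⟨hvx, by
          rintro (t | ⟨s, hs, hsx⟩)
          exacts [hx.1 t, hxS s hs hsx]⟩) hx.2.1 hxa
        exact hxJ i hi hxi.symm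
      · obtain ⟨s, hs, hsx⟩ := hSd x ⟨hxv, hvx, hxf⟩ hx.1
        exact hxS s hs hsx
    have := hw _ _ hM' hM
    rw [hMc, hcard {a} hQ, Finset.card_singleton] at this
    omega
end SimpleGraph

/-! ### The graphs C₇ and T₁₀ and the traces of vertices attached to them -/

namespace SimpleGraph

variable {V : Type*} {G : SimpleGraph V}

/-- The graph on `Fin k` with the given edges. -/
def ofEdges {k : ℕ} (E : List (Fin k × Fin k)) : SimpleGraph (Fin k) where
  Adj i j := i ≠ j ∧ ((i, j) ∈ E ∨ (j, i) ∈ E)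
  symm := ⟨fun _ _ h => ⟨h.1.symm, h.2.symm⟩⟩
  loopless := ⟨fun _ h => h.1 rfl⟩

instance {k : ℕ} (E : List (Fin k × Fin k)) : DecidableRel (ofEdges E).Adj :=
  fun _ _ => inferInstanceAs (Decidable (_ ∧ _))

/-- The cycle `C₇`. -/
def heptagon : SimpleGraph (Fin 7) :=
  ofEdges [(0, 1), (1, 2), (2, 3), (3, 4), (4, 5), (5, 6), (6, 0)]

/-- The exceptional graph `T₁₀`: the paths `0-1-2-3`, `0-6-5-4` and `0-7-8-9` with a common end,
and the triangle on their other ends. -/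
def tripod : SimpleGraph (Fin 10) :=
  ofEdges [(0, 1), (1, 2), (2, 3), (3, 4), (4, 5), (5, 6), (6, 0), (0, 7), (7, 8), (8, 9), (9, 3),
    (9, 4)]

instance : DecidableRel heptagon.Adj := inferInstanceAs (DecidableRel (ofEdges _).Adj)

instance : DecidableRel tripod.Adj := inferInstanceAs (DecidableRel (ofEdges _).Adj)

section Attach

variable {k : ℕ} {Γ : SimpleGraph (Fin k)} {f : Fin k → V} {v : V} {A S : Finset V} {α : ℕ}

/-- `i` and `j` are joined in `Γ` neither by a path of length two nor by one of length three. -/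
def Spread (Γ : SimpleGraph (Fin k)) (i j : Fin k) : Prop :=
  (∀ x, Γ.Adj i x → ¬ Γ.Adj x j) ∧
    ∀ x y, Γ.Adj i x → Γ.Adj x y → Γ.Adj y j → x ≠ j → y = i

instance [DecidableRel Γ.Adj] (i j : Fin k) : Decidable (Spread Γ i j) :=
  inferInstanceAs (Decidable (_ ∧ _))

/-- A path of length two or three between two neighbours of `a` closes a 4-cycle or a 5-cycle
through `a`. -/
theorem NoShortCycle.spread (h : G.NoShortCycle) (hf : Function.Injective f)
    (hadj : ∀ i j, G.Adj (f i) (f j) ↔ Γ.Adj i j) {a : V} (ha : ∀ i, f i ≠ a) {i j : Fin k}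
    (hi : G.Adj a (f i)) (hj : G.Adj a (f j)) (hij : i ≠ j) : Spread Γ i j := by
  constructor
  · intro x h1 h2
    exact h.four hi ((hadj _ _).2 h1) ((hadj _ _).2 h2) hj.symm (ha x).symm (hf.ne hij)
  · intro x y h1 h2 h3 hx
    by_contra hy
    exact h.five hi ((hadj _ _).2 h1) ((hadj _ _).2 h2) ((hadj _ _).2 h3) hj.symm (ha x).symm
      (ha y).symm (hf.ne (Ne.symm hy)) (hf.ne hij) (hf.ne hx)

theorem IsAttachment.ne_of_mem (hA : IsAttachment Γ G f v A S α) {a : V} (ha : a ∈ A)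
    (i : Fin k) : f i ≠ a := by
  rintro rfl
  exact hA.not_adj i (hA.adj _ ha)

/-- Two members of `A` have no common neighbour in the copy, and no adjacent ones. -/
theorem IsAttachment.disjoint (hA : IsAttachment Γ G f v A S α) (h : G.NoShortCycle) {a b : V}
    (ha : a ∈ A) (hb : b ∈ A) (hab : a ≠ b) {i : Fin k} (hi : G.Adj a (f i)) :
    ¬ G.Adj b (f i) ∧ ∀ j, Γ.Adj i j → ¬ G.Adj b (f j) := by
  constructor
  · intro hj
    exact h.four hi hj.symm (hA.adj b hb).symm (hA.adj a ha) hab (hA.ne i)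
  · intro j hij hj
    by_cases hadj : G.Adj a b
    · exact h.four hi ((hA.adj_iff _ _).2 hij) hj.symm hadj.symm (hA.ne_of_mem ha j).symm
        (hA.ne_of_mem hb i)
    · exact h.five (hA.adj a ha) hi ((hA.adj_iff _ _).2 hij) hj.symm (hA.adj b hb).symm
        (hA.ne i).symm (hA.ne j).symm (hA.ne_of_mem ha j).symm hab (hA.ne_of_mem hb i)

/-- `J` is a set of fewer than `α` pairwise nonadjacent vertices that together with `l` dominates
`Γ`, and avoids `l`. -/
def IsMove (Γ : SimpleGraph (Fin k)) (α : ℕ) (l J : List (Fin k)) : Prop :=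
  (∀ i ∈ J, ∀ j ∈ J, ¬ Γ.Adj i j) ∧ (∀ i ∈ J, i ∉ l) ∧
    (∀ i, i ∈ J ∨ i ∈ l ∨ ∃ j ∈ J, Γ.Adj j i) ∧ J.length < α

/-- The constraints on the traces `l`, `l'` of two nonadjacent attached vertices, when `l'` avoids
`J` and the independent sets of size at least `α` in the list `B` are taken into account. -/
def Survives (Γ : SimpleGraph (Fin k)) (B : List (List (Fin k))) (l J l' : List (Fin k)) : Prop :=
  (∀ i ∈ l, ∀ j ∈ l', i ≠ j ∧ ¬ Γ.Adj i j) ∧ (∀ i ∈ l', i ∉ J) ∧ ∀ K ∈ B, ∃ i ∈ K, i ∈ l ∨ i ∈ l'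

instance [DecidableRel Γ.Adj] (l J : List (Fin k)) : Decidable (IsMove Γ α l J) :=
  @instDecidableAnd _ _ (List.decidableBAll _ _) (@instDecidableAnd _ _ (List.decidableBAll _ _)
    (@instDecidableAnd _ _ (Nat.decidableForallFin _) inferInstance))

instance [DecidableRel Γ.Adj] (B : List (List (Fin k))) (l J l' : List (Fin k)) :
    Decidable (Survives Γ B l J l') :=
  @instDecidableAnd _ _ (List.decidableBAll _ _)
    (@instDecidableAnd _ _ (List.decidableBAll _ _) (List.decidableBAll _ _))

/-- After a move, `S`, `a` and `J` together are too small to be maximal, which provides `b`. By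
`IsAttachment.disjoint` the two traces are separated, since `v` would otherwise close a short cycle.
If some `K ∈ B` missed both traces, then `a`, `b` and `K` would violate `card_le`. What remains is a
condition on finite lists that `decide` can treat. -/
theorem IsAttachment.exists_survives (hA : IsAttachment Γ G f v A S α) (h : G.NoShortCycle)
    {B L : List (List (Fin k))}
    (hB : ∀ K ∈ B, (∀ i ∈ K, ∀ j ∈ K, ¬ Γ.Adj i j) ∧ K.Nodup ∧ α ≤ K.length)
    (hL : ∀ p : Fin k → Prop, (∀ i j, p i → p j → i ≠ j → Spread Γ i j) →
      ∃ l ∈ L, ∀ i, p i ↔ i ∈ l)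
    {a : V} (ha : a ∈ A) {l J : List (Fin k)} (hl : ∀ i, G.Adj a (f i) ↔ i ∈ l)
    (hJ : IsMove Γ α l J) :
    ∃ b ∈ A, b ≠ a ∧ ¬ G.Adj a b ∧ ∃ l' ∈ L, (∀ i, G.Adj b (f i) ↔ i ∈ l') ∧
      Survives Γ B l J l' := by
  classical
  obtain ⟨h1, h2, h3, h4⟩ := hJ
  obtain ⟨b, hb, hba, hab, hbJ⟩ := hA.exists_of_card_lt a ha J.toFinset (by simpa using h1)
    (by
      intro i hi
      rw [hl]
      exact h2 i (by simpa using hi))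
    (by simpa [hl] using h3) (J.toFinset_card_le.trans_lt h4)
  obtain ⟨l', hl', hbl⟩ := hL (fun i => G.Adj b (f i)) fun i j hi hj hij =>
    h.spread hA.inj hA.adj_iff (hA.ne_of_mem hb) hi hj hij
  refine ⟨b, hb, hba, hab, l', hl', hbl, ?_, ?_, ?_⟩
  · intro i hi j hj
    have := hA.disjoint h ha hb hba.symm ((hl i).2 hi)
    constructor
    · rintro rfl
      exact this.1 ((hbl i).2 hj)
    · exact fun hij => this.2 j hij ((hbl j).2 hj)
  · intro i hi hiJ
    exact hbJ i (by simpa using hiJ) ((hbl i).2 hi)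
  · intro K hK
    by_contra! hno
    obtain ⟨hK1, hK2, hK3⟩ := hB K hK
    have := hA.card_le {a, b} (by
      intro x hx
      simp only [Finset.mem_insert, Finset.mem_singleton] at hx
      rcases hx with rfl | rfl <;> assumption) K.toFinset
      (by
        have hab' : ¬ G.Adj b a := fun t => hab t.symm
        simp [hab, hab'])
      (by simpa using hK1)
      (by
        intro x hx i hi
        have := hno i (by simpa using hi)
        simp only [Finset.mem_insert, Finset.mem_singleton] at hx
        rcases hx with rfl | rfl
        · rw [hl]
          exact this.1
        · rw [hbl]
          exact this.2)
    rw [Finset.card_pair hba.symm, List.toFinset_card_of_nodup hK2] at this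
    omega

end Attach

/-- Coding subsets as bit masks turns quantification over subsets into a bounded quantification over
numbers that the kernel can evaluate. -/
theorem exists_testBit_eq {k : ℕ} (p : Fin k → Prop) :
    ∃ m < 2 ^ k, ∀ i : Fin k, m.testBit i = true ↔ p i := by
  classical
  refine ⟨Nat.ofBits fun i => decide (p i), Nat.ofBits_lt_two_pow _, fun i => ?_⟩
  rw [Nat.testBit_ofBits_lt _ _ i.2]
  simp

/-- The possible traces of a vertex attached to `C₇`. -/
def heptagonTraces : List (List (Fin 7)) :=
  [[], [0], [1], [2], [3], [4], [5], [6], [0, 1], [1, 2], [2, 3], [3, 4], [4, 5], [5, 6], [6, 0]]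

/-- The possible traces of a vertex attached to `T₁₀`. -/
def tripodTraces : List (List (Fin 10)) :=
  [[], [0], [1], [2], [3], [4], [5], [6], [7], [8], [9], [0, 1], [1, 2], [2, 3], [4, 5], [5, 6],
    [6, 0], [0, 7], [7, 8], [8, 9]]

/-- If the binary digits of `m` that are one pairwise form members of `L`, they form a member. -/
def IsTraceMask {k : ℕ} (L : List (List (Fin k))) (m : ℕ) : Prop :=
  (∀ i j : Fin k, m.testBit i = true → m.testBit j = true → i ≠ j → [i, j] ∈ L ∨ [j, i] ∈ L) →
    ∃ l ∈ L, ∀ i : Fin k, m.testBit i = true ↔ i ∈ l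

instance {k : ℕ} (L : List (List (Fin k))) : DecidablePred (IsTraceMask L) := fun _ =>
  @instDecidableForall _ _
    (@Nat.decidableForallFin _ _ fun _ => @Nat.decidableForallFin _ _ fun _ => inferInstance)
    (List.decidableBEx _ _)

theorem heptagon_trace (p : Fin 7 → Prop)
    (hp : ∀ i j, p i → p j → i ≠ j → Spread heptagon i j) :
    ∃ l ∈ heptagonTraces, ∀ i, p i ↔ i ∈ l := by
  obtain ⟨m, hm, hmp⟩ := exists_testBit_eq p
  have h1 : ∀ i j, i ≠ j → Spread heptagon i j → [i, j] ∈ heptagonTraces ∨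
      [j, i] ∈ heptagonTraces := by decide +kernel
  have h2 : ∀ m < 2 ^ 7, IsTraceMask heptagonTraces m := by decide +kernel
  obtain ⟨l, hl, hml⟩ := h2 m hm fun i j hi hj hij =>
    h1 i j hij (hp i j ((hmp i).1 hi) ((hmp j).1 hj) hij)
  exact ⟨l, hl, fun i => by rw [← hmp, hml]⟩

theorem tripod_trace (p : Fin 10 → Prop)
    (hp : ∀ i j, p i → p j → i ≠ j → Spread tripod i j) :
    ∃ l ∈ tripodTraces, ∀ i, p i ↔ i ∈ l := by
  obtain ⟨m, hm, hmp⟩ := exists_testBit_eq p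
  -- The edges of the triangle on 3, 4, 9 are missing from `tripodTraces`: their ends are joined by
  -- a path of length two.
  have h1 : ∀ i j, i ≠ j → Spread tripod i j → [i, j] ∈ tripodTraces ∨
      [j, i] ∈ tripodTraces := by decide +kernel
  have h2 : ∀ m < 2 ^ 10, IsTraceMask tripodTraces m := by decide +kernel
  obtain ⟨l, hl, hml⟩ := h2 m hm fun i j hi hj hij =>
    h1 i j hij (hp i j ((hmp i).1 hi) ((hmp j).1 hj) hij)
  exact ⟨l, hl, fun i => by rw [← hmp, hml]⟩

/-- The independent sets of size three of `C₇`. -/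
def heptagonTriples : List (List (Fin 7)) :=
  [[0, 2, 4], [0, 2, 5], [0, 3, 5], [1, 3, 5], [1, 3, 6], [1, 4, 6], [2, 4, 6]]

/-- The independent sets of size four of `T₁₀`. -/
def tripodQuadruples : List (List (Fin 10)) :=
  [[1, 3, 5, 7], [1, 3, 6, 7], [1, 4, 6, 7], [2, 4, 6, 7], [0, 2, 4, 8], [0, 2, 5, 8],
    [0, 3, 5, 8], [1, 3, 5, 8], [1, 3, 6, 8], [1, 4, 6, 8], [2, 4, 6, 8], [0, 2, 5, 9],
    [1, 5, 7, 9], [2, 5, 7, 9], [1, 6, 7, 9], [2, 6, 7, 9]]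

/-- No vertex can be attached to a copy of `T₁₀`. -/
theorem IsAttachment.not_adj_tripod {f : Fin 10 → V} {v : V} {A S : Finset V}
    (hA : IsAttachment tripod G f v A S 4) (h : G.NoShortCycle) {a : V} (ha : a ∈ A)
    (i : Fin 10) : ¬ G.Adj a (f i) := by
  intro hi
  have hB : ∀ K ∈ tripodQuadruples, (∀ i ∈ K, ∀ j ∈ K, ¬ tripod.Adj i j) ∧ K.Nodup ∧
      4 ≤ K.length := by decide +kernel
  have move := fun {a : V} (ha : a ∈ A) {l J : List (Fin 10)}
    (hl : ∀ i, G.Adj a (f i) ↔ i ∈ l) (hJ : IsMove tripod 4 l J) =>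
    hA.exists_survives h hB tripod_trace ha hl hJ
  -- the ends of the three paths, in the order from `0`
  set P : Fin 3 → Fin 10 := ![1, 6, 7] with hP
  set Q : Fin 3 → Fin 10 := ![2, 5, 8] with hQ
  set R : Fin 3 → Fin 10 := ![3, 4, 9] with hR
  have third : ∀ p q : Fin 3, p ≠ q → ∃ r, r ≠ p ∧ r ≠ q := by decide
  -- every attached vertex attaches to some `Q p` and to no vertex outside `{P p, Q p}`
  have easy : ∀ l ∈ tripodTraces, l ≠ [] → (∃ p, l.Perm [Q p] ∨ l.Perm [P p, Q p]) ∨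
      ∃ J ∈ [[2, 5, 8], [3, 5, 7], [1, 5, 8], [0, 5, 8], [2, 6, 8], [0, 2, 8], [1, 4, 7],
        [1, 5, 9], [2, 5, 7], [0, 2, 5]], IsMove tripod 4 l J ∧
        ∀ l' ∈ tripodTraces, ¬ Survives tripod tripodQuadruples l J l' := by decide +kernel
  have trace : ∀ b ∈ A, ∀ l ∈ tripodTraces, (∀ i, G.Adj b (f i) ↔ i ∈ l) → l ≠ [] →
      ∃ p, l.Perm [Q p] ∨ l.Perm [P p, Q p] := by
    intro b hb l hl hbl hne
    rcases easy l hl hne with h1 | ⟨J, -, hJ, hno⟩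
    · exact h1
    · obtain ⟨c, -, -, -, l', hl', -, hs⟩ := move hb hbl hJ
      exact (hno l' hl' hs).elim
  -- a vertex attached to `Q p` alone forces one attached to both `P q` and `Q q`
  have moveOfEnds : ∀ p q r, p ≠ q → r ≠ p → r ≠ q → IsMove tripod 4 [Q p] [0, Q r, R q] ∧
      ∀ l' ∈ tripodTraces, Survives tripod tripodQuadruples [Q p] [0, Q r, R q] l' →
        P q ∈ l' ∧ Q q ∈ l' := by decide +kernel
  have single : ∀ b ∈ A, ∀ p q, p ≠ q → (∀ i, G.Adj b (f i) ↔ i ∈ [Q p]) →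
      ∃ c ∈ A, G.Adj c (f (P q)) ∧ G.Adj c (f (Q q)) := by
    intro b hb p q hpq hbl
    obtain ⟨r, hrp, hrq⟩ := third p q hpq
    obtain ⟨hm, hs⟩ := moveOfEnds p q r hpq hrp hrq
    obtain ⟨c, hc, -, -, l', hl', hcl, hsl⟩ := move hb hbl hm
    have := hs l' hl' hsl
    exact ⟨c, hc, (hcl _).2 this.1, (hcl _).2 this.2⟩
  have movesOfEnds : ∀ p q r, p ≠ q → r ≠ p → r ≠ q →
      IsMove tripod 4 [P p, Q p] [P q, P r, R p] ∧ IsMove tripod 4 [P p, Q p] [P r, Q q, R p] ∧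
      (∀ l' ∈ tripodTraces, Survives tripod tripodQuadruples [P p, Q p] [P q, P r, R p] l' →
        (Q q ∈ l' ∨ Q r ∈ l') ∧ P q ∉ l' ∧ P r ∉ l') ∧
      ∀ l' ∈ tripodTraces, Survives tripod tripodQuadruples [P p, Q p] [P r, Q q, R p] l' →
        Q r ∈ l' ∧ P r ∉ l' := by decide +kernel
  have notmem : ∀ p q, Q q ∉ [P p] ∧ (Q q ∈ [Q p] → p = q) ∧ (Q q ∈ [P p, Q p] → p = q) := by
    decide
  -- Such a `b` yields a vertex `c` with trace {Q q}, then `single` yields `d` attached to both P r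
  -- and Q r, and a second move from `b` yields `e` attached to Q r but not to P r. So `d` and `e`
  -- are distinct with a common neighbour in the copy, which together with `v` gives a 4-cycle.
  have double : ∀ b ∈ A, ∀ p, (∀ i, G.Adj b (f i) ↔ i ∈ [P p, Q p]) → False := by
    intro b hb p hbl
    obtain ⟨q, r, hpq, hrp, hrq⟩ : ∃ q r, p ≠ q ∧ r ≠ p ∧ r ≠ q := by
      clear hbl
      revert p
      decide
    -- some vertex is attached to a single `Q q`
    obtain ⟨c, hc, q, hpq, hcl⟩ : ∃ c ∈ A, ∃ q, p ≠ q ∧ ∀ i, G.Adj c (f i) ↔ i ∈ [Q q] := by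
      obtain ⟨hm, -, hs, -⟩ := movesOfEnds p q r hpq hrp hrq
      obtain ⟨c, hc, -, -, l', hl', hcl, hsl⟩ := move hb hbl hm
      obtain ⟨hQ', hP1, hP2⟩ := hs l' hl' hsl
      have key : ∀ t, p ≠ t → Q t ∈ l' → P t ∉ l' → ∃ c ∈ A, ∃ q, p ≠ q ∧
          ∀ i, G.Adj c (f i) ↔ i ∈ [Q q] := by
        intro t hpt hQt hPt
        obtain ⟨u, hu | hu⟩ := trace c hc l' hl' hcl (List.ne_nil_of_mem hQt)
        · have e := (notmem u t).2.1 (hu.mem_iff.1 hQt)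
          subst e
          exact ⟨c, hc, u, hpt, fun i => by rw [hcl, hu.mem_iff]⟩
        · have e := (notmem u t).2.2 (hu.mem_iff.1 hQt)
          subst e
          exact (hPt (hu.mem_iff.2 (by simp))).elim
      rcases hQ' with h1 | h1
      · exact key q hpq h1 hP1
      · exact key r hrp.symm h1 hP2
    obtain ⟨r, hrp, hrq⟩ := third p q hpq
    obtain ⟨d, hd, hdP, hdQ⟩ := single c hc q r hrq.symm hcl
    obtain ⟨-, hm, -, hs⟩ := movesOfEnds p q r hpq hrp hrq
    obtain ⟨e, he, -, -, l', hl', hel, hsl⟩ := move hb hbl hm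
    obtain ⟨h1, h2⟩ := hs l' hl' hsl
    rw [← hel] at h1 h2
    by_cases hde : d = e
    · subst hde
      exact h2 hdP
    · exact (hA.disjoint h hd he hde hdQ).1 h1
  obtain ⟨l, hl, hal⟩ := tripod_trace (fun i => G.Adj a (f i)) fun i j hi hj hij =>
    h.spread hA.inj hA.adj_iff (hA.ne_of_mem ha) hi hj hij
  obtain ⟨p, hp | hp⟩ := trace a ha l hl hal (List.ne_nil_of_mem ((hal i).1 hi))
  · obtain ⟨q, hpq⟩ : ∃ q, p ≠ q := by
      clear hp
      revert p
      decide
    obtain ⟨c, hc, hcP, hcQ⟩ := single a ha p q hpq fun i => by rw [hal, hp.mem_iff]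
    obtain ⟨l', hl', hcl⟩ := tripod_trace (fun i => G.Adj c (f i)) fun i j hi hj hij =>
      h.spread hA.inj hA.adj_iff (hA.ne_of_mem hc) hi hj hij
    obtain ⟨u, hu | hu⟩ := trace c hc l' hl' hcl (List.ne_nil_of_mem ((hcl _).1 hcP))
    · have h1 := hu.mem_iff.1 ((hcl _).1 hcP)
      have : ∀ u q, P q ∉ [Q u] := by decide
      exact this u q h1
    · exact double c hc u fun i => by rw [hcl, hu.mem_iff]
  · exact double a ha p fun i => by rw [hal, hp.mem_iff]

end SimpleGraph

/-! ### Exceptional components before and after a removal -/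

namespace SimpleGraph

variable {V : Type*} {G : SimpleGraph V}

theorem IsClosedCopy.mem_of_reachable {k : ℕ} {Γ : SimpleGraph (Fin k)} {f : Fin k → V}
    (hf : G.IsClosedCopy Γ f) {x y : V} (hxy : G.Reachable x y) (hx : ∃ i, f i = x) :
    ∃ i, f i = y := by
  obtain ⟨w⟩ := hxy
  induction w with
  | nil => exact hx
  | cons h _ ih =>
    obtain ⟨i, rfl⟩ := hx
    exact ih (hf.closed i _ h)

theorem heptagon_not_simplicial : ∀ i, ∃ j l, heptagon.Adj i j ∧ heptagon.Adj i l ∧ j ≠ l ∧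
    ¬ heptagon.Adj j l := by decide +kernel

theorem tripod_not_simplicial : ∀ i, ∃ j l, tripod.Adj i j ∧ tripod.Adj i l ∧ j ≠ l ∧
    ¬ tripod.Adj j l := by decide +kernel

theorem heptagon_maximalIndependent : heptagon.IsMaximalIndependent {0, 2, 4} :=
  isMaximalIndependent_iff.2 (by decide +kernel)

theorem tripod_maximalIndependent : tripod.IsMaximalIndependent {1, 3, 5, 7} :=
  isMaximalIndependent_iff.2 (by decide +kernel)

/-- A copy that is closed after removal of `N[v]` but not before is attached to a neighbour of
`v`, and `v` is in no simplex. -/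
theorem IsClosedCopy.closed_or_attached [Finite V] (h : G.NoShortCycle) (hw : G.WellCovered)
    {k : ℕ} {Γ : SimpleGraph (Fin k)} {f : Fin k → V} {v : V}
    (hf : (G.isolate {v}).IsClosedCopy Γ f)
    (hΓ : ∀ i, ∃ j l, Γ.Adj i j ∧ Γ.Adj i l ∧ j ≠ l ∧ ¬ Γ.Adj j l) :
    G.IsClosedCopy Γ f ∨ ¬ G.InSimplex v ∧ ∃ a i, G.Adj v a ∧ G.Adj a (f i) := by
  have hcl : ∀ x, x ∉ G.closedNbhd {v} ↔ x ≠ v ∧ ¬ G.Adj v x := by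
    intro x
    simp [closedNbhd]
  have hfv : ∀ i, f i ≠ v ∧ ¬ G.Adj v (f i) := by
    intro i
    obtain ⟨j, -, hj, -⟩ := hΓ i
    exact (hcl _).1 ((hf.adj_iff i j).2 hj).2.1
  have hadj : ∀ i j, G.Adj (f i) (f j) ↔ Γ.Adj i j := by
    intro i j
    rw [← hf.adj_iff]
    exact ⟨fun t => ⟨t, (hcl _).2 (hfv i), (hcl _).2 (hfv j)⟩, fun t => t.1⟩
  have hout : ∀ i x, G.Adj (f i) x → (∃ j, f j = x) ∨ G.Adj v x := by
    intro i x hx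
    by_cases hvx : G.Adj v x
    · exact Or.inr hvx
    · refine Or.inl (hf.closed i x ⟨hx, (hcl _).2 (hfv i), (hcl _).2 ⟨?_, hvx⟩⟩)
      rintro rfl
      exact (hfv i).2 hx.symm
  by_cases hc : ∀ i x, G.Adj (f i) x → ∃ j, f j = x
  · exact Or.inl ⟨hf.inj, hadj, hc⟩
  · push Not at hc
    obtain ⟨i, x, hix, hx⟩ := hc
    have hvx : G.Adj v x := by
      rcases hout i x hix with ⟨j, hj⟩ | hvx
      · exact (hx j hj).elim
      · exact hvx
    -- A simplicial vertex near `f i` would lie in the copy, which has none by `hΓ`, or be a common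
    -- neighbour of the nonadjacent vertices `f i` and `v`. From `f i` the property spreads through
    -- `x` to `v`.
    have hi : ¬ G.InSimplex (f i) := by
      rintro ⟨y, hy, hys⟩
      have hyf : (∃ j, f j = y) ∨ G.Adj (f i) y ∧ G.Adj v y := by
        rcases hy with rfl | hy
        · exact Or.inl ⟨i, rfl⟩
        · rcases hout i y hy.symm with h1 | h1
          · exact Or.inl h1
          · exact Or.inr ⟨hy.symm, h1⟩
      rcases hyf with ⟨j, rfl⟩ | ⟨h1, h2⟩
      · obtain ⟨l, m, hl, hm, hlm, hlm'⟩ := hΓ j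
        exact hlm' ((hadj l m).1 (hys _ _ ((hadj _ _).2 hl) ((hadj _ _).2 hm) (hf.inj.ne hlm)))
      · exact (hfv i).2 (hys _ _ h2.symm h1.symm (hfv i).1.symm)
    exact Or.inr ⟨not_inSimplex_of_adj h hw (not_inSimplex_of_adj h hw hi hix) hvx.symm, x, i, hvx,
      hix.symm⟩

theorem isClosedCopy_tripod_of_isolate_singleton [Finite V] (h : G.NoShortCycle)
    (hw : G.WellCovered) {f : Fin 10 → V} {v : V} (hf : (G.isolate {v}).IsClosedCopy tripod f) :
    G.IsClosedCopy tripod f := by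
  rcases hf.closed_or_attached h hw tripod_not_simplicial with h1 | ⟨hv, a, i, hva, hai⟩
  · exact h1
  · obtain ⟨A, S, ha, hA⟩ := exists_isAttachment h hw hv hf
      (fun i => ⟨_, (tripod_not_simplicial i).choose_spec.choose_spec.1⟩)
      tripod_maximalIndependent (α := 4) (by decide) hva
    exact (hA.not_adj_tripod h ha i hai).elim

theorem isolate_empty : G.isolate ∅ = G := by
  ext x y
  simp [isolate, closedNbhd]

/-- The copy of T₁₀ built around a C₇ is a component only after the removal of N[S]; this undoes the
removal, one vertex of `S` at a time. -/
theorem isClosedCopy_tripod_of_isolate [Finite V] {f : Fin 10 → V} (S : Finset V)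
    (h : G.NoShortCycle) (hw : G.WellCovered) (hS : ∀ x ∈ S, ∀ y ∈ S, ¬ G.Adj x y)
    (hf : (G.isolate (S : Set V)).IsClosedCopy tripod f) : G.IsClosedCopy tripod f := by
  classical
  induction S using Finset.induction_on with
  | empty => simpa [isolate_empty] using hf
  | insert s S hs ih =>
    have hS' : ∀ x ∈ S, ∀ y ∈ S, ¬ G.Adj x y := fun x hx y hy =>
      hS x (Finset.mem_insert_of_mem hx) y (Finset.mem_insert_of_mem hy)
    refine ih hS' (isClosedCopy_tripod_of_isolate_singleton (v := s) (h.mono (isolate_le _))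
      (hw.isolate (by simpa using hS')) ?_)
    rw [← isolate_insert]
    · simpa using hf
    · rintro (h1 | ⟨t, ht, hts⟩)
      · exact hs (by simpa using h1)
      · exact hS t (Finset.mem_insert_of_mem (by simpa using ht)) s (Finset.mem_insert_self _ _) hts

theorem IsClosedCopy.comp {k : ℕ} {Γ : SimpleGraph (Fin k)} {f : Fin k → V}
    (hf : G.IsClosedCopy Γ f) (σ : Equiv.Perm (Fin k))
    (hσ : ∀ i j, Γ.Adj (σ i) (σ j) ↔ Γ.Adj i j) : G.IsClosedCopy Γ (f ∘ σ) where
  inj := hf.inj.comp σ.injective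
  adj_iff i j := by simp [hf.adj_iff, hσ]
  closed i w hw := by
    obtain ⟨j, hj⟩ := hf.closed _ w hw
    exact ⟨σ.symm j, by simpa using hj⟩

/-- A copy of `C₇` attached to two vertices `a`, `b` with traces `{0}` and `{3, 4}` extends to a
closed copy of `T₁₀`. -/
theorem IsAttachment.isClosedCopy_tripod [Finite V] {f : Fin 7 → V} {v : V} {A S : Finset V}
    (hA : IsAttachment heptagon G f v A S 3) (h : G.NoShortCycle) {a b : V} (ha : a ∈ A)
    (hb : b ∈ A) (hba : b ≠ a) (hab : ¬ G.Adj a b) (hfa : ∀ i, G.Adj a (f i) ↔ i = 0)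
    (hfb : ∀ i, G.Adj b (f i) ↔ i = 3 ∨ i = 4) :
    (G.isolate (S : Set V)).IsClosedCopy tripod
      ![f 0, f 1, f 2, f 3, f 4, f 5, f 6, a, v, b] := by
  classical
  have hba' : ¬ G.Adj b a := fun t => hab t.symm
  have hcard : ∀ Q ⊆ A, ∀ J : Finset (Fin 7), (∀ x ∈ Q, ∀ y ∈ Q, ¬ G.Adj x y) →
      (∀ i ∈ J, ∀ j ∈ J, ¬ heptagon.Adj i j) → (∀ a ∈ Q, ∀ i ∈ J, ¬ G.Adj a (f i)) →
      Q.card + J.card ≤ 4 := hA.card_le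
  -- there is no third vertex in `A`
  have hAab : ∀ c ∈ A, c = a ∨ c = b := by
    intro c hc
    by_contra! hne
    have ha0 := (hfa 0).2 rfl
    have hb3 := (hfb 3).2 (by decide)
    have hb4 := (hfb 4).2 (by decide)
    have c0 := (hA.disjoint h ha hc hne.1.symm ha0).1
    have c1 := (hA.disjoint h ha hc hne.1.symm ha0).2 1 (by decide)
    have c2 := (hA.disjoint h hb hc hne.2.symm hb3).2 2 (by decide)
    have c4 := (hA.disjoint h hb hc hne.2.symm hb4).1
    have c5 := (hA.disjoint h hb hc hne.2.symm hb4).2 5 (by decide)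
    have c6 := (hA.disjoint h ha hc hne.1.symm ha0).2 6 (by decide)
    -- In each case vertices of `A` and of the copy form an independent set of five vertices, one
    -- more than `hcard` allows.
    by_cases hac : G.Adj a c
    · have hbc : ¬ G.Adj b c := fun hbc =>
        h.four (hA.adj a ha) hac hbc.symm (hA.adj b hb).symm (hA.adj c hc).ne hba.symm
      have hcb : ¬ G.Adj c b := fun t => hbc t.symm
      have := hcard {b, c} (by simp [Finset.insert_subset_iff, hb, hc]) {0, 2, 5}
        (by simp [hbc, hcb]) (by decide) (by simp [hfb, c0, c2, c5])
      rw [Finset.card_pair hne.2.symm] at this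
      revert this
      decide
    · have hca : ¬ G.Adj c a := fun t => hac t.symm
      by_cases hbc : G.Adj b c
      · have := hcard {a, c} (by simp [Finset.insert_subset_iff, ha, hc]) {2, 4, 6}
          (by simp [hac, hca]) (by decide) (by simp [hfa, c2, c4, c6])
        rw [Finset.card_pair hne.1.symm] at this
        revert this
        decide
      · have hcb : ¬ G.Adj c b := fun t => hbc t.symm
        have := hcard {a, b, c} (by simp [Finset.insert_subset_iff, ha, hb, hc]) {1, 5}
          (by simp [hac, hca, hab, hba', hbc, hcb]) (by decide)
          (by simp [hfa, hfb, c1, c5])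
        rw [Finset.card_insert_of_notMem (by simp [hba.symm, hne.1.symm]),
          Finset.card_pair hne.2.symm] at this
        revert this
        decide
  set g : Fin 10 → V := ![f 0, f 1, f 2, f 3, f 4, f 5, f 6, a, v, b] with hg
  have hcl : ∀ x, x ∉ G.closedNbhd (S : Set V) ↔ ∃ i, g i = x := by
    intro x
    rw [hA.notMem_iff]
    constructor
    · rintro (rfl | hx | ⟨i, rfl⟩)
      · exact ⟨8, rfl⟩
      · rcases hAab x hx with rfl | rfl
        exacts [⟨7, rfl⟩, ⟨9, rfl⟩]
      · exact ⟨i.castLE (by decide), by fin_cases i <;> rfl⟩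
    · rintro ⟨i, rfl⟩
      fin_cases i <;> simp [g, ha, hb]
  have hva := hA.adj a ha
  have hvb := hA.adj b hb
  have hfv : ∀ i, ¬ G.Adj (f i) v := fun i t => hA.not_adj i t.symm
  have hfa' : ∀ i, G.Adj (f i) a ↔ i = 0 := fun i => by rw [G.adj_comm, hfa]
  have hfb' : ∀ i, G.Adj (f i) b ↔ i = 3 ∨ i = 4 := fun i => by rw [G.adj_comm, hfb]
  have hadj : ∀ i j, G.Adj (g i) (g j) ↔ tripod.Adj i j := by
    intro i j
    fin_cases i <;> fin_cases j <;>
      simp [g, hA.adj_iff, hfa, hfb, hfa', hfb', hfv, hA.not_adj, hva, hvb, hva.symm, hvb.symm, hab,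
        hba'] <;> decide
  refine ⟨?_, ?_, ?_⟩
  · have n1 := fun i => hA.ne_of_mem ha i
    have n2 := fun i => hA.ne_of_mem hb i
    have n3 := hA.ne
    have n1' := fun i => (hA.ne_of_mem ha i).symm
    have n2' := fun i => (hA.ne_of_mem hb i).symm
    have n3' := fun i => (hA.ne i).symm
    intro i j hij
    fin_cases i <;> fin_cases j <;>
      simp [g, hA.inj.eq_iff, n1, n2, n3, n1', n2', n3', hba, hba.symm, hva.ne, hvb.ne, hva.ne',
        hvb.ne'] at hij ⊢
  · intro i j
    rw [← hadj]
    exact ⟨fun t => t.1, fun t => ⟨t, (hcl _).2 ⟨i, rfl⟩, (hcl _).2 ⟨j, rfl⟩⟩⟩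
  · intro i w hiw
    exact (hcl w).1 hiw.2.2

/-- A copy of `C₇` closed after removal of `N[v]` is closed or part of a closed copy of `T₁₀`. -/
theorem isClosedCopy_heptagon_of_isolate_singleton [Finite V] (h : G.NoShortCycle)
    (hw : G.WellCovered) {f : Fin 7 → V} {v : V} (hf : (G.isolate {v}).IsClosedCopy heptagon f) :
    G.IsClosedCopy heptagon f ∨
      ∃ g, G.IsClosedCopy tripod g ∧ ∀ i, ∃ j, g j = f i := by
  rcases hf.closed_or_attached h hw heptagon_not_simplicial with h1 | ⟨hv, a, i, hva, hai⟩
  · exact Or.inl h1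
  right
  have hB : ∀ K ∈ heptagonTriples, (∀ i ∈ K, ∀ j ∈ K, ¬ heptagon.Adj i j) ∧ K.Nodup ∧
      3 ≤ K.length := by decide +kernel
  have hσ : ∀ m i j : Fin 7, heptagon.Adj (Equiv.addLeft m i) (Equiv.addLeft m j) ↔
      heptagon.Adj i j := by decide +kernel
  -- the trace of `a` may be taken to be `{0}` or `{3, 4}`
  obtain ⟨m, hm⟩ : ∃ m : Fin 7, (∀ i, G.Adj a (f (m + i)) ↔ i ∈ [0]) ∨
      ∀ i, G.Adj a (f (m + i)) ↔ i ∈ [3, 4] := by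
    obtain ⟨A, S, ha, hA⟩ := exists_isAttachment h hw hv hf
      (fun i => ⟨_, (heptagon_not_simplicial i).choose_spec.choose_spec.1⟩)
      heptagon_maximalIndependent (α := 3) (by decide) hva
    obtain ⟨l, hl, hal⟩ := heptagon_trace (fun i => G.Adj a (f i)) fun i j hi hj hij =>
      h.spread hA.inj hA.adj_iff (hA.ne_of_mem ha) hi hj hij
    have hrot : ∀ l ∈ heptagonTraces, l ≠ [] → ∃ m : Fin 7, (∀ i, m + i ∈ l ↔ i ∈ [0]) ∨
      ∀ i, m + i ∈ l ↔ i ∈ [3, 4] := by decide +kernel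
    obtain ⟨m, hm⟩ := hrot l hl (List.ne_nil_of_mem ((hal i).1 hai))
    exact ⟨m, by simpa only [hal] using hm⟩
  have hf' := hf.comp (Equiv.addLeft m) (hσ m)
  set f' := f ∘ Equiv.addLeft m with hf'_def
  -- The attachment is chosen anew for the rotated copy; the trace of `a` depends neither on `A` nor
  -- on `S`.
  obtain ⟨A, S, ha, hA⟩ := exists_isAttachment h hw hv hf'
      (fun i => ⟨_, (heptagon_not_simplicial i).choose_spec.choose_spec.1⟩)
      heptagon_maximalIndependent (α := 3) (by decide) hva
  -- Each of the two traces forces a second attached vertex with the other trace, so both cases lead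
  -- to the same T₁₀.
  have hm0 : IsMove heptagon 3 [0] [2, 5] ∧ ∀ l' ∈ heptagonTraces,
      Survives heptagon heptagonTriples [0] [2, 5] l' → l' = [3, 4] := by decide +kernel
  have hm3 : IsMove heptagon 3 [3, 4] [1, 6] ∧ ∀ l' ∈ heptagonTraces,
      Survives heptagon heptagonTriples [3, 4] [1, 6] l' → l' = [0] := by decide +kernel
  obtain ⟨g, hg, hgf⟩ : ∃ g, (G.isolate (S : Set V)).IsClosedCopy tripod g ∧
      ∀ i, ∃ j, g j = f' i := by
    rcases hm with hm | hm
    · obtain ⟨b, hb, hba, hab, l', hl', hbl, hs⟩ :=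
        hA.exists_survives h hB heptagon_trace ha (l := [0]) hm hm0.1
      obtain rfl := hm0.2 l' hl' hs
      exact ⟨_, hA.isClosedCopy_tripod h ha hb hba hab (fun i => (hm i).trans (by simp))
        (fun i => (hbl i).trans (by simp)),
        fun i => ⟨i.castLE (by decide), by fin_cases i <;> rfl⟩⟩
    · obtain ⟨b, hb, hba, hab, l', hl', hbl, hs⟩ :=
        hA.exists_survives h hB heptagon_trace ha (l := [3, 4]) hm hm3.1
      obtain rfl := hm3.2 l' hl' hs
      exact ⟨_, hA.isClosedCopy_tripod h hb ha hba.symm (fun t => hab t.symm)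
        (fun i => (hbl i).trans (by simp)) (fun i => (hm i).trans (by simp)),
        fun i => ⟨i.castLE (by decide), by fin_cases i <;> rfl⟩⟩
  refine ⟨g, isClosedCopy_tripod_of_isolate S h hw hA.indep hg, fun i => ?_⟩
  obtain ⟨j, hj⟩ := hgf (-m + i)
  exact ⟨j, by simpa [hf'_def] using hj⟩

end SimpleGraph

/-! ### The structure of well-covered graphs without 4-cycles and 5-cycles -/

namespace SimpleGraph

variable {V : Type*} {G : SimpleGraph V}

/-- `v` lies in a component that is a copy of `C₇` or of `T₁₀`. -/
def InExceptional (G : SimpleGraph V) (v : V) : Prop :=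
  (∃ f, G.IsClosedCopy heptagon f ∧ ∃ i, f i = v) ∨ ∃ f, G.IsClosedCopy tripod f ∧ ∃ i, f i = v

theorem InExceptional.of_reachable {v x : V} (hx : G.InExceptional x) (hvx : G.Reachable v x) :
    G.InExceptional v := by
  rcases hx with ⟨f, hf, hi⟩ | ⟨f, hf, hi⟩
  · exact Or.inl ⟨f, hf, hf.mem_of_reachable hvx.symm hi⟩
  · exact Or.inr ⟨f, hf, hf.mem_of_reachable hvx.symm hi⟩

/-- A vertex exceptional after removal of `N[w]` is exceptional. -/
theorem InExceptional.of_isolate [Finite V] (h : G.NoShortCycle) (hw : G.WellCovered) {w x : V}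
    (hx : (G.isolate {w}).InExceptional x) : G.InExceptional x := by
  rcases hx with ⟨f, hf, i, rfl⟩ | ⟨f, hf, i, rfl⟩
  · rcases isClosedCopy_heptagon_of_isolate_singleton h hw hf with h1 | ⟨g, hg, hgf⟩
    · exact Or.inl ⟨f, h1, i, rfl⟩
    · exact Or.inr ⟨g, hg, hgf i⟩
  · exact Or.inr ⟨f, isClosedCopy_tripod_of_isolate_singleton h hw hf, i, rfl⟩

theorem isClosedCopy_heptagon {f : Fin 7 → V} (hf : Function.Injective f)
    (hN : ∀ i x, G.Adj (f i) x ↔ x = f (i + 1) ∨ x = f (i - 1)) :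
    G.IsClosedCopy heptagon f where
  inj := hf
  adj_iff i j := by
    rw [hN, hf.eq_iff, hf.eq_iff]
    revert i j
    decide +kernel
  closed i w hw := by
    rcases (hN i w).1 hw with rfl | rfl
    exacts [⟨_, rfl⟩, ⟨_, rfl⟩]

/-- The case in which removing a closed neighbourhood always leaves only vertices in simplices. -/
theorem inExceptional_of_isolate_inSimplex [Finite V] (h : G.NoShortCycle) (hw : G.WellCovered)
    {v : V} (hbad : ∀ x, G.Reachable v x → ¬ G.InSimplex x)
    (hgood : ∀ w x, G.Reachable v w → G.Reachable v x → x ≠ w → ¬ G.Adj w x →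
      (G.isolate {w}).InSimplex x) : G.InExceptional v := by
  classical
  have hR : ∀ {x y}, G.Reachable v x → G.Adj x y → G.Reachable v y :=
    fun hx hxy => hx.trans hxy.reachable
  have hcl : ∀ w x, x ∉ G.closedNbhd {w} ↔ x ≠ w ∧ ¬ G.Adj w x := by
    intro w x
    simp [closedNbhd]
  have hns : ∀ x, G.Reachable v x → ¬ G.IsSimplicial x := fun x hx hs =>
    hbad x hx ⟨x, Or.inl rfl, hs⟩
  -- at distance two from `w`, every vertex becomes simplicial
  have key : ∀ w a b, G.Reachable v w → G.Adj w a → G.Adj a b → b ≠ w → ¬ G.Adj w b →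
      (G.isolate {w}).IsSimplicial b := by
    intro w a b hw' hwa hab hbw hwb
    have hRb := hR (hR hw' hwa) hab
    obtain ⟨y, hyb, hys⟩ := hgood w b hw' hRb hbw hwb
    rcases hyb with rfl | hyb
    · exact hys
    exfalso
    obtain ⟨hyw, hwy⟩ := (hcl _ _).1 hyb.2.1
    have hRy := hR hRb hyb.1.symm
    -- If `a` and `y` are adjacent, a neighbour `c` of `y` not adjacent to `a` survives and must be
    -- adjacent to `b`, giving the 4-cycle a, b, c, y. If not, the absence of 5-cycles lets all
    -- neighbours of `y` survive, so `y` is simplicial already in `G`.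
    by_cases hay : G.Adj a y
    · obtain ⟨c, hyc, hca, hca'⟩ : ∃ c, G.Adj y c ∧ c ≠ a ∧ ¬ G.Adj c a :=
        exists_far_of_not_inSimplex h (hbad a (hR hw' hwa)) hay
      have hcw : c ≠ w := by
        rintro rfl
        exact hwy hyc.symm
      have hwc : ¬ G.Adj w c := fun t => h.four hwa hay hyc t.symm hyw.symm hca.symm
      have hcb : c ≠ b := by
        rintro rfl
        exact hca' hab.symm
      have := hys c b ⟨hyc, hyb.2.1, (hcl _ _).2 ⟨hcw, hwc⟩⟩ hyb hcb
      exact h.four hab this.1.symm hyc.symm hay.symm hca.symm hyb.1.ne'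
    · refine hns y hRy fun p q hp hq hpq => ?_
      have hout : ∀ p, G.Adj y p → p ∉ G.closedNbhd {w} := by
        intro p hp
        refine (hcl _ _).2 ⟨?_, fun hwp => ?_⟩
        · rintro rfl
          exact hwy hp.symm
        · refine h.five hwa hab hyb.1.symm hp hwp.symm hbw.symm hyw.symm ?_ ?_ ?_
          · rintro rfl
            exact hwy hwa
          · rintro rfl
            exact hay hp.symm
          · rintro rfl
            exact hwb hwp
      exact (hys p q ⟨hp, hyb.2.1, hout p hp⟩ ⟨hq, hyb.2.1, hout q hq⟩ hpq).1
  -- a neighbour `c` of `b` other than `a` survives the removal of `N[w]`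
  have surv : ∀ w a b c, G.Adj w a → G.Adj a b → b ≠ w → ¬ G.Adj w b → G.Adj b c → c ≠ a →
      (G.isolate {w}).Adj b c := by
    intro w a b c hwa hab hbw hwb hbc hca
    refine ⟨hbc, (hcl _ _).2 ⟨hbw, hwb⟩, (hcl _ _).2 ⟨?_, fun hwc => ?_⟩⟩
    · rintro rfl
      exact hwb hbc.symm
    · exact h.four hwa hab hbc hwc.symm hbw.symm hca.symm
  have far : ∀ a b, G.Reachable v b → G.Adj b a → ∃ w, G.Adj w a ∧ b ≠ w ∧ ¬ G.Adj w b := by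
    intro a b hRb hba
    obtain ⟨w, h1, h2, h3⟩ := exists_far_of_not_inSimplex h (hbad b hRb) hba
    exact ⟨w, h1.symm, h2.symm, h3⟩
  -- In a triangle a, b, c, a neighbour `d` of `b` not adjacent to `a` would by `key` be adjacent to
  -- `c`, giving the 4-cycle a, b, d, c.
  have notri : ∀ a b c, G.Reachable v a → G.Adj a b → G.Adj b c → ¬ G.Adj a c := by
    intro a b c hRa hab hbc hac
    obtain ⟨w, hwa, hbw, hwb⟩ := far a b (hR hRa hab) hab.symm
    have hs := key w a b (hR hRa hwa.symm) hwa hab hbw hwb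
    obtain ⟨d, hbd, hda, hda'⟩ : ∃ d, G.Adj b d ∧ d ≠ a ∧ ¬ G.Adj d a :=
      exists_far_of_not_inSimplex h (hbad a hRa) hab
    have hcd : c ≠ d := by
      rintro rfl
      exact hda' hac.symm
    have := hs c d (surv w a b c hwa hab hbw hwb hbc hac.ne')
      (surv w a b d hwa hab hbw hwb hbd hda) hcd
    exact h.four hab hbd this.1.symm hac.symm hda.symm hbc.ne
  -- The neighbours of `b` other than `a` survive the removal of N[w], hence are pairwise adjacent
  -- by `key`; without triangles there is only one.
  have deg2 : ∀ b a, G.Reachable v b → G.Adj b a →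
      ∃ c, G.Adj b c ∧ c ≠ a ∧ ∀ d, G.Adj b d ↔ d = a ∨ d = c := by
    intro b a hRb hba
    obtain ⟨w, hwa, hbw, hwb⟩ := far a b hRb hba
    have hs := key w a b (hR (hR hRb hba) hwa.symm) hwa hba.symm hbw hwb
    obtain ⟨c, hbc, hca, -⟩ : ∃ d, G.Adj b d ∧ d ≠ a ∧ ¬ G.Adj d a :=
      exists_far_of_not_inSimplex h (hbad a (hR hRb hba)) hba.symm
    refine ⟨c, hbc, hca, fun d => ⟨fun hbd => ?_, ?_⟩⟩
    · by_contra! hne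
      have := hs d c (surv w a b d hwa hba.symm hbw hwb hbd hne.1)
        (surv w a b c hwa hba.symm hbw hwb hbc hca) hne.2
      exact notri b d c hRb hbd this.1 hbc
    · rintro (rfl | rfl)
      exacts [hba, hbc]
  obtain ⟨a, hva⟩ : ∃ a, G.Adj v a := by
    by_contra! hno
    exact hns v (Reachable.refl v) fun y z hy => (hno y hy).elim
  have hRv : G.Reachable v v := Reachable.refl v
  obtain ⟨a', hva', haa, hNv⟩ := deg2 v a hRv hva
  obtain ⟨b, hab, hbv, hNa⟩ := deg2 a v (hR hRv hva) hva.symm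
  obtain ⟨b', hab', hbv', hNa'⟩ := deg2 a' v (hR hRv hva') hva'.symm
  have hRb := hR (hR hRv hva) hab
  have hRb' := hR (hR hRv hva') hab'
  obtain ⟨c, hbc, hca, hNb⟩ := deg2 b a hRb hab.symm
  obtain ⟨c', hbc', hca', hNb'⟩ := deg2 b' a' hRb' hab'.symm
  have naa : ¬ G.Adj a a' := fun t => notri v a a' hRv hva t hva'
  have nvb : ¬ G.Adj v b := fun t => notri v a b hRv hva hab t
  have nvb' : ¬ G.Adj v b' := fun t => notri v a' b' hRv hva' hab' t
  have nbb : b ≠ b' := by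
    rintro rfl
    exact h.four hva hab hab'.symm hva'.symm hbv.symm haa.symm
  have nab' : a ≠ b' := by
    rintro rfl
    exact nvb' hva
  have na'b : a' ≠ b := by
    rintro rfl
    exact nvb hva'
  have nbb' : ¬ G.Adj b b' := fun t =>
    h.five hva hab t hab'.symm hva'.symm hbv.symm hbv'.symm nab' haa.symm na'b.symm
  have nvc : ¬ G.Adj v c := by
    intro t
    rcases (hNv c).1 t with rfl | rfl
    · exact hca rfl
    · rcases (hNa' b).1 hbc.symm with rfl | rfl
      · exact hbv rfl
      · exact nbb rfl
  have nvc' : ¬ G.Adj v c' := by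
    intro t
    rcases (hNv c').1 t with rfl | rfl
    · rcases (hNa b').1 hbc'.symm with rfl | rfl
      · exact hbv' rfl
      · exact nbb rfl
    · exact hca' rfl
  -- Otherwise, also if `c = c'`, a maximal independent set containing `v`, `c` and `c'` could
  -- exchange `v` for `a` and `a'`, whose other neighbours `b` and `b'` it omits. The adjacency
  -- closes the 7-cycle.
  have hcc : G.Adj c c' := by
    by_contra hcc
    have hcc' : ¬ G.Adj c' c := fun t => hcc t.symm
    have nvc1 : ¬ G.Adj c v := fun t => nvc t.symm
    have nvc1' : ¬ G.Adj c' v := fun t => nvc' t.symm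
    obtain ⟨M, hIM, hM⟩ := exists_maximalIndependent (G := G) (I := {v, c, c'})
      (by simp [hcc, hcc', nvc, nvc', nvc1, nvc1'])
    obtain ⟨hi, -⟩ := isMaximalIndependent_iff.1 hM
    have hvM : v ∈ M := hIM (by simp)
    have hcM : c ∈ M := hIM (by simp)
    have hcM' : c' ∈ M := hIM (by simp)
    have haM : ∀ x ∈ M.erase v, ¬ G.Adj a x := by
      intro x hx hax
      obtain ⟨hxv, hxM⟩ := Finset.mem_erase.1 hx
      rcases (hNa x).1 hax with rfl | rfl
      · exact hxv rfl
      · exact hi _ hxM _ hcM hbc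
    have haM' : ∀ x ∈ M.erase v, ¬ G.Adj a' x := by
      intro x hx hax
      obtain ⟨hxv, hxM⟩ := Finset.mem_erase.1 hx
      rcases (hNa' x).1 hax with rfl | rfl
      · exact hxv rfl
      · exact hi _ hxM _ hcM' hbc'
    have hle := hw.card_le hM (I := insert a (insert a' (M.erase v))) (by
      intro x hx y hy hxy
      simp only [Finset.mem_insert] at hx hy
      rcases hx with rfl | rfl | hx' <;> rcases hy with rfl | rfl | hy'
      · exact hxy.ne rfl
      · exact naa hxy
      · exact haM _ hy' hxy
      · exact naa hxy.symm
      · exact hxy.ne rfl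
      · exact haM' _ hy' hxy
      · exact haM _ hx' hxy.symm
      · exact haM' _ hx' hxy.symm
      · exact hi x (Finset.mem_of_mem_erase hx') y (Finset.mem_of_mem_erase hy') hxy)
    rw [Finset.card_insert_of_notMem, Finset.card_insert_of_notMem, Finset.card_erase_of_mem hvM]
      at hle
    · have := Finset.card_pos.2 ⟨v, hvM⟩
      omega
    · exact fun t => hi v hvM a' (Finset.mem_of_mem_erase t) hva'
    · rw [Finset.mem_insert]
      rintro (t | t)
      · exact haa t.symm
      · exact hi v hvM a (Finset.mem_of_mem_erase t) hva
  have hNc : ∀ d, G.Adj c d ↔ d = b ∨ d = c' := by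
    obtain ⟨e, -, -, he⟩ := deg2 c b (hR hRb hbc) hbc.symm
    have : c' = e := by
      rcases (he c').1 hcc with rfl | h1
      · exact (nbb' hbc'.symm).elim
      · exact h1
    rwa [← this] at he
  have hNc' : ∀ d, G.Adj c' d ↔ d = b' ∨ d = c := by
    obtain ⟨e, -, -, he⟩ := deg2 c' b' (hR hRb' hbc') hbc'.symm
    have : c = e := by
      rcases (he c).1 hcc.symm with rfl | h1
      · exact (nbb' hbc).elim
      · exact h1
    rwa [← this] at he
  have ncv : c ≠ v := by
    rintro rfl
    exact nvb hbc.symm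
  have ncv' : c' ≠ v := by
    rintro rfl
    exact nvb' hbc'.symm
  have nca' : c ≠ a' := by
    rintro rfl
    exact nvc hva'
  have nc'a : c' ≠ a := by
    rintro rfl
    exact nvc' hva
  have ncb' : c ≠ b' := by
    rintro rfl
    exact nbb' hbc
  have nc'b : c' ≠ b := by
    rintro rfl
    exact nbb' hbc'.symm
  have hva1 := hva.ne
  have hva1' := hva'.ne
  have hab1 := hab.ne
  have hab1' := hab'.ne
  have hbc1 := hbc.ne
  have hbc1' := hbc'.ne
  have hcc1 := hcc.ne
  refine Or.inl ⟨![v, a, b, c, c', b', a'], isClosedCopy_heptagon ?_ ?_, 0, rfl⟩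
  · have hnd : [v, a, b, c, c', b', a'].Nodup := by
      simp only [List.nodup_cons, List.mem_cons, List.not_mem_nil, or_false, not_or,
        not_false_eq_true, List.nodup_nil, and_true]
      exact ⟨⟨hva1, hbv.symm, ncv.symm, ncv'.symm, hbv'.symm, hva1'⟩,
        ⟨hab1, hca.symm, nc'a.symm, nab', haa.symm⟩, ⟨hbc1, nc'b.symm, nbb, na'b.symm⟩,
        ⟨hcc1, ncb', nca'⟩, ⟨hbc1'.symm, hca'⟩, hab1'.symm⟩
    exact List.nodup_ofFn.1 hnd
  · intro i x
    fin_cases i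
    · exact (hNv x).trans Iff.rfl
    · exact (hNa x).trans or_comm
    · exact (hNb x).trans or_comm
    · exact (hNc x).trans or_comm
    · exact (hNc' x).trans Iff.rfl
    · exact (hNb' x).trans Iff.rfl
    · exact (hNa' x).trans Iff.rfl

/-- In a well-covered graph without 4-cycles and 5-cycles every vertex lies in a simplex or in a
component isomorphic to `C₇` or `T₁₀`. -/
theorem WellCovered.inSimplex_or_inExceptional [Finite V] (h : G.NoShortCycle)
    (hw : G.WellCovered) (v : V) : G.InSimplex v ∨ G.InExceptional v := by
  classical
  cases nonempty_fintype V
  -- The induction is on the number of non-isolated vertices, which drops when N[w] is isolated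
  -- because `w` has a neighbour.
  induction hn : (Finset.univ.filter fun x => ∃ y, G.Adj x y).card using Nat.strong_induction_on
    generalizing G v with
  | _ n ih =>
    by_cases hv : G.InSimplex v
    · exact Or.inl hv
    right
    have hbad : ∀ x, G.Reachable v x → ¬ G.InSimplex x := by
      rintro x ⟨p⟩
      induction p with
      | nil => exact hv
      | cons hadj _ ihp => exact ihp (not_inSimplex_of_adj h hw hv hadj)
    by_cases hgood : ∀ w x, G.Reachable v w → G.Reachable v x → x ≠ w → ¬ G.Adj w x →
        (G.isolate {w}).InSimplex x
    · exact inExceptional_of_isolate_inSimplex h hw hbad hgood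
    · push Not at hgood
      obtain ⟨w, x, hw', hx, -, -, hxb⟩ := hgood
      refine InExceptional.of_reachable (InExceptional.of_isolate h hw (w := w)
        ((ih _ ?_ (h.mono (isolate_le _)) (hw.isolate (by simp)) x rfl).resolve_left hxb)) hx
      rw [← hn]
      refine Finset.card_lt_card ⟨?_, fun hsub => ?_⟩
      · intro y hy
        simp only [Finset.mem_filter, Finset.mem_univ, true_and] at hy ⊢
        obtain ⟨z, hz⟩ := hy
        exact ⟨z, hz.1⟩
      · obtain ⟨z, hz⟩ : ∃ z, G.Adj w z := by
          by_contra! hno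
          exact hbad w hw' ⟨w, Or.inl rfl, fun y z hy => (hno y hy).elim⟩
        have := hsub (show w ∈ _ by simpa using ⟨z, hz⟩)
        simp only [Finset.mem_filter, Finset.mem_univ, true_and] at this
        obtain ⟨u, hu⟩ := this
        exact hu.2.1 (Or.inl rfl)

end SimpleGraph

/-! ### From the structure to well-dominated graphs -/

namespace SimpleGraph

variable {V : Type*} {G : SimpleGraph V}

/-- Every element of a minimal dominating set dominates some vertex that no other one does. -/
theorem isMinimalDominating_iff {S : Finset V} :
    G.IsMinimalDominating S ↔ G.IsDominating S ∧
      ∀ s ∈ S, ∃ p, (s = p ∨ G.Adj s p) ∧ ∀ t ∈ S, t = p ∨ G.Adj t p → t = s := by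
  classical
  constructor
  · intro h
    refine ⟨h.1, fun s hs => ?_⟩
    have hn : ¬ G.IsDominating (S.erase s) := fun hd =>
      Finset.notMem_erase s S (h.2 hd (Finset.erase_subset s S) hs)
    unfold IsDominating at hn
    push Not at hn
    obtain ⟨p, hp, hp'⟩ := hn
    have key : ∀ t ∈ S, t = p ∨ G.Adj t p → t = s := by
      intro t ht htp
      by_contra hts
      rcases htp with rfl | htp
      · exact hp (Finset.mem_erase.2 ⟨hts, ht⟩)
      · exact hp' t (Finset.mem_erase.2 ⟨hts, ht⟩) htp
    refine ⟨p, ?_, key⟩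
    rcases h.1 p with h1 | ⟨u, hu, hup⟩
    · exact Or.inl (key p h1 (Or.inl rfl)).symm
    · obtain rfl := key u hu (Or.inr hup)
      exact Or.inr hup
  · rintro ⟨hd, hp⟩
    refine ⟨hd, fun T hT hTS s hs => ?_⟩
    obtain ⟨p, -, hp⟩ := hp s hs
    rcases hT p with h1 | ⟨u, hu, hup⟩
    · exact hp p (hTS h1) (Or.inl rfl) ▸ h1
    · exact hp u (hTS hu) (Or.inr hup) ▸ hu

/-- Maximal independent sets are minimal dominating sets: among the members, each one dominates
itself alone. -/
theorem WellDominated.wellCovered (h : G.WellDominated) : G.WellCovered := by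
  have key : ∀ S, G.IsMaximalIndependent S → G.IsMinimalDominating S := by
    intro S hS
    obtain ⟨hi, hd⟩ := isMaximalIndependent_iff.1 hS
    refine isMinimalDominating_iff.2 ⟨fun v => ?_, fun s hs => ⟨s, Or.inl rfl, ?_⟩⟩
    · by_cases hv : v ∈ S
      exacts [Or.inl hv, Or.inr (hd v hv)]
    · rintro t ht (rfl | hts)
      exacts [rfl, (hi t ht s hs hts).elim]
  exact fun S T hS hT => h S T (key S hS) (key T hT)

/-- The binary digits of `m` code a minimal dominating set of the graph on `Fin k` with the closed
neighbourhoods `nb`. -/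
def IsMinimalDominatingMask {k : ℕ} (nb : Fin k → List (Fin k)) (m : ℕ) : Prop :=
  (∀ v, ∃ u ∈ nb v, m.testBit u = true) ∧
    ∀ s : Fin k, m.testBit s = true → ∃ p ∈ nb s, ∀ u ∈ nb p, m.testBit u = true → u = s

instance {k : ℕ} (nb : Fin k → List (Fin k)) : DecidablePred (IsMinimalDominatingMask nb) :=
  fun _ => @instDecidableAnd _ _ (@Nat.decidableForallFin _ _ fun _ => List.decidableBEx _ _)
    (@Nat.decidableForallFin _ _ fun _ => @instDecidableForall _ _ inferInstance
      (@List.decidableBEx _ _ (fun _ => List.decidableBAll _ _) _))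

/-- The minimal dominating sets of a graph on `Fin k`, in terms of lists `nb` of closed
neighbourhoods and of sets coded by the binary digits of a number, all have size `c`. -/
theorem wellDominated_of_testBit {k : ℕ} {Γ : SimpleGraph (Fin k)} (nb : Fin k → List (Fin k))
    (hnb : ∀ u v, u ∈ nb v ↔ u = v ∨ Γ.Adj u v) (c : ℕ)
    (h : ∀ m < 2 ^ k, IsMinimalDominatingMask nb m →
      (List.finRange k).countP (fun i : Fin k => m.testBit i) = c) :
    Γ.WellDominated := by
  have key : ∀ S, Γ.IsMinimalDominating S → S.card = c := by
    intro S hS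
    obtain ⟨hd, hp⟩ := isMinimalDominating_iff.1 hS
    obtain ⟨m, hm, hmS⟩ := exists_testBit_eq (fun i => i ∈ S)
    rw [← h m hm ⟨?_, ?_⟩]
    · have : S = ((List.finRange k).filter fun i : Fin k => m.testBit i).toFinset := by
        ext i
        simp [hmS]
      rw [this, List.countP_eq_length_filter,
        List.toFinset_card_of_nodup ((List.nodup_finRange k).filter _)]
    · intro v
      rcases hd v with hv | ⟨u, hu, huv⟩
      · exact ⟨v, (hnb v v).2 (Or.inl rfl), (hmS v).2 hv⟩
      · exact ⟨u, (hnb u v).2 (Or.inr huv), (hmS u).2 hu⟩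
    · intro s hs
      obtain ⟨p, hsp, hp⟩ := hp s ((hmS s).1 hs)
      refine ⟨p, (hnb p s).2 (hsp.imp Eq.symm fun t => t.symm), fun u hu hus => ?_⟩
      exact hp u ((hmS u).1 hus) ((hnb u p).1 hu)
  exact fun S T hS hT => (key S hS).trans (key T hT).symm

theorem heptagon_wellDominated : heptagon.WellDominated :=
  wellDominated_of_testBit
    ![[0, 1, 6], [1, 0, 2], [2, 1, 3], [3, 2, 4], [4, 3, 5], [5, 4, 6], [6, 5, 0]]
    (by decide +kernel) 3 (by decide +kernel)

theorem tripod_wellDominated : tripod.WellDominated :=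
  wellDominated_of_testBit
    ![[0, 1, 6, 7], [1, 0, 2], [2, 1, 3], [3, 2, 4, 9], [4, 3, 5, 9], [5, 4, 6], [6, 5, 0],
      [7, 0, 8], [8, 7, 9], [9, 8, 3, 4]]
    (by decide +kernel) 4 (by decide +kernel)

/-- A minimal dominating set meets a component in a minimal dominating set of it. -/
theorem IsClosedCopy.isMinimalDominating [DecidableEq V] {k : ℕ} {Γ : SimpleGraph (Fin k)}
    {f : Fin k → V} (hf : G.IsClosedCopy Γ f) {S : Finset V} (hS : G.IsMinimalDominating S) :
    Γ.IsMinimalDominating (Finset.univ.filter fun i => f i ∈ S) := by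
  obtain ⟨hd, hp⟩ := isMinimalDominating_iff.1 hS
  refine isMinimalDominating_iff.2 ⟨fun i => ?_, fun i hi => ?_⟩
  · rcases hd (f i) with h1 | ⟨u, hu, hui⟩
    · exact Or.inl (by simpa using h1)
    · obtain ⟨j, rfl⟩ := hf.closed i u hui.symm
      exact Or.inr ⟨j, by simpa using hu, (hf.adj_iff _ _).1 hui⟩
  · simp only [Finset.mem_filter, Finset.mem_univ, true_and] at hi ⊢
    obtain ⟨p, hip, hp⟩ := hp (f i) hi
    obtain ⟨j, rfl⟩ : ∃ j, f j = p := by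
      rcases hip with rfl | hip
      exacts [⟨i, rfl⟩, hf.closed i p hip]
    refine ⟨j, hip.imp (fun t => hf.inj t) (hf.adj_iff _ _).1, fun t ht htj => ?_⟩
    exact hf.inj (hp _ ht (htj.imp (congrArg f) (hf.adj_iff _ _).2))

theorem IsClosedCopy.card_filter [DecidableEq V] {k : ℕ} {Γ : SimpleGraph (Fin k)} {f : Fin k → V}
    (hf : G.IsClosedCopy Γ f) (S : Finset V) (P : V → Prop) [DecidablePred P]
    (hP : ∀ x, P x ↔ ∃ i, f i = x) :
    (S.filter P).card = (Finset.univ.filter fun i => f i ∈ S).card := by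
  rw [← Finset.card_image_of_injective _ hf.inj]
  congr 1
  ext x
  simp only [Finset.mem_filter, Finset.mem_image, Finset.mem_univ, true_and, hP]
  constructor
  · rintro ⟨hx, i, rfl⟩
    exact ⟨i, hx, rfl⟩
  · rintro ⟨i, hi, rfl⟩
    exact ⟨hi, i, rfl⟩

theorem IsClosedCopy.not_inSimplex {k : ℕ} {Γ : SimpleGraph (Fin k)} {f : Fin k → V}
    (hf : G.IsClosedCopy Γ f)
    (hΓ : ∀ i, ∃ j l, Γ.Adj i j ∧ Γ.Adj i l ∧ j ≠ l ∧ ¬ Γ.Adj j l) (i : Fin k) :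
    ¬ G.InSimplex (f i) := by
  rintro ⟨y, hy, hys⟩
  obtain ⟨j, rfl⟩ : ∃ j, f j = y := by
    rcases hy with rfl | hy
    exacts [⟨i, rfl⟩, hf.closed i y hy.symm]
  obtain ⟨l, m, hl, hm, hlm, hlm'⟩ := hΓ j
  exact hlm' ((hf.adj_iff l m).1
    (hys _ _ ((hf.adj_iff _ _).2 hl) ((hf.adj_iff _ _).2 hm) (hf.inj.ne hlm)))

theorem InExceptional.not_inSimplex {v : V} (hv : G.InExceptional v) : ¬ G.InSimplex v := by
  rcases hv with ⟨f, hf, i, rfl⟩ | ⟨f, hf, i, rfl⟩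
  · exact hf.not_inSimplex heptagon_not_simplicial i
  · exact hf.not_inSimplex tripod_not_simplicial i

theorem connected_of_exists_lt {k : ℕ} {Γ : SimpleGraph (Fin (k + 1))}
    (h : ∀ i, i ≠ 0 → ∃ j < i, Γ.Adj j i) : Γ.Connected := by
  have key : ∀ i, Γ.Reachable 0 i := by
    intro i
    induction i using WellFoundedLT.induction with
    | ind i ih =>
      by_cases hi : i = 0
      · rw [hi]
      · obtain ⟨j, hj, hji⟩ := h i hi
        exact (ih j hj).trans hji.reachable
  exact ⟨fun i j => (key i).symm.trans (key j)⟩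

theorem heptagon_connected : heptagon.Connected := connected_of_exists_lt (by decide +kernel)

theorem tripod_connected : tripod.Connected := connected_of_exists_lt (by decide +kernel)

theorem IsClosedCopy.reachable_iff {k : ℕ} {Γ : SimpleGraph (Fin k)} {f : Fin k → V}
    (hf : G.IsClosedCopy Γ f) (hΓ : Γ.Connected) (i : Fin k) (x : V) :
    G.Reachable (f i) x ↔ ∃ j, f j = x := by
  constructor
  · exact fun h => hf.mem_of_reachable h ⟨i, rfl⟩
  · rintro ⟨j, rfl⟩
    exact (hΓ i j).map (⟨f, fun {a b} h => (hf.adj_iff a b).2 h⟩ : Γ →g G)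

/-- The local structure of the well-dominated graphs without 4-cycles and 5-cycles. -/
def IsSimplexPartitioned (G : SimpleGraph V) : Prop :=
  (∀ v, G.InSimplex v ∨ G.InExceptional v) ∧
    ∀ v x y, G.IsSimplicial x → G.IsSimplicial y → (x = v ∨ G.Adj x v) → (y = v ∨ G.Adj y v) →
      x = y ∨ G.Adj x y

theorem IsSimplicial.mem_iff {x y : V} (hx : G.IsSimplicial x) (hy : G.IsSimplicial y)
    (hxy : x = y ∨ G.Adj x y) (u : V) : (x = u ∨ G.Adj x u) ↔ (y = u ∨ G.Adj y u) := by
  have key : ∀ {x y}, G.IsSimplicial x → G.Adj x y → (x = u ∨ G.Adj x u) →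
      (y = u ∨ G.Adj y u) := by
    rintro x y hx hxy (rfl | hu)
    · exact Or.inr hxy.symm
    · by_cases h : y = u
      exacts [Or.inl h, Or.inr (hx y u hxy hu h)]
  rcases hxy with rfl | hxy
  · rfl
  · exact ⟨key hx hxy, key hy hxy.symm⟩

/-- Some `s ∈ S` dominates `x`, so it lies in the simplex. Let `a ∈ S` also lie there, with a vertex
`p` that only `a` dominates. If `p` is in the simplex, then `s` dominates it and `s = a`. If not,
`p` lies in another simplex, whose centre can be dominated only by `a`; the two simplices then meet
in `a`, hence coincide, and `p` was in the first one after all. -/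
theorem IsSimplexPartitioned.card_simplex [Fintype V] [DecidableEq V]
    (h : G.IsSimplexPartitioned) {S : Finset V} (hS : G.IsMinimalDominating S) {x : V}
    (hx : G.IsSimplicial x) (P : V → Prop) [DecidablePred P] (hP : ∀ u, P u ↔ x = u ∨ G.Adj x u) :
    (S.filter P).card = 1 := by
  obtain ⟨hd, hp⟩ := isMinimalDominating_iff.1 hS
  have hmeet : ∀ y, ∃ s ∈ S, y = s ∨ G.Adj y s := by
    intro y
    rcases hd y with h1 | ⟨u, hu, huy⟩
    exacts [⟨y, h1, Or.inl rfl⟩, ⟨u, hu, Or.inr huy.symm⟩]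
  have hcl : ∀ {y a b}, G.IsSimplicial y → (y = a ∨ G.Adj y a) → (y = b ∨ G.Adj y b) →
      a = b ∨ G.Adj a b := by
    rintro y a b hy (rfl | ha) (rfl | hb)
    · exact Or.inl rfl
    · exact Or.inr hb
    · exact Or.inr ha.symm
    · by_cases hab : a = b
      exacts [Or.inl hab, Or.inr (hy a b ha hb hab)]
  obtain ⟨s, hs, hxs⟩ := hmeet x
  rw [Finset.card_eq_one]
  refine ⟨s, Finset.eq_singleton_iff_unique_mem.2
    ⟨Finset.mem_filter.2 ⟨hs, (hP s).2 hxs⟩, fun a ha => ?_⟩⟩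
  obtain ⟨haS, hxa⟩ := Finset.mem_filter.1 ha
  rw [hP] at hxa
  obtain ⟨p, hap, hp⟩ := hp a haS
  by_cases hxp : x = p ∨ G.Adj x p
  · exact (hp s hs (hcl hx hxs hxp)).symm
  exfalso
  have hap' : G.Adj a p := by
    rcases hap with rfl | hap
    exacts [(hxp hxa).elim, hap]
  rcases h.1 p with ⟨y, hyp, hy⟩ | hpe
  · obtain ⟨t, ht, hyt⟩ := hmeet y
    obtain rfl := hp t ht (hcl hy hyt hyp)
    exact hxp ((hx.mem_iff hy (h.2 t x y hx hy hxa hyt) p).2 hyp)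
  · exact (hpe.of_reachable hap'.reachable).not_inSimplex ⟨x, hxa, hx⟩

/-- Simplices and exceptional components partition the vertices, and the number of elements of a
minimal dominating set in a part depends only on the part. The sizes are compared as sums over the
parts. -/
theorem IsSimplexPartitioned.wellDominated [Finite V] (h : G.IsSimplexPartitioned) :
    G.WellDominated := by
  classical
  cases nonempty_fintype V
  choose! c hc using fun v (hv : G.InSimplex v) => hv
  -- the simplex or exceptional component of a vertex
  set part : V → Finset V := fun v => Finset.univ.filter fun u =>
    if G.InSimplex v then c v = u ∨ G.Adj (c v) u else G.Reachable v u with hpart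
  have hmem : ∀ v u, u ∈ part v ↔
      if G.InSimplex v then c v = u ∨ G.Adj (c v) u else G.Reachable v u := by simp [hpart]
  have hself : ∀ v, v ∈ part v := by
    intro v
    rw [hmem]
    split_ifs with hv
    exacts [(hc v hv).1, Reachable.refl v]
  have heq : ∀ v u, u ∈ part v → part u = part v := by
    intro v u hu
    ext w
    rw [hmem] at hu
    rw [hmem, hmem]
    by_cases hv : G.InSimplex v
    · rw [if_pos hv] at hu
      have hu' : G.InSimplex u := ⟨c v, hu, (hc v hv).2⟩
      rw [if_pos hv, if_pos hu']
      exact (hc u hu').2.mem_iff (hc v hv).2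
        (h.2 u _ _ (hc u hu').2 (hc v hv).2 (hc u hu').1 hu) w
    · rw [if_neg hv] at hu
      have hu' : ¬ G.InSimplex u :=
        (((h.1 v).resolve_left hv).of_reachable hu.symm).not_inSimplex
      rw [if_neg hv, if_neg hu']
      exact ⟨hu.trans, hu.symm.trans⟩
  have hfib : ∀ (S : Finset V) v, S.filter (fun u => part u = part v) =
      S.filter fun u => u ∈ part v := by
    intro S v
    refine Finset.filter_congr fun u _ => ⟨fun e => e ▸ hself u, heq v u⟩
  intro S T hS hT
  rw [Finset.card_eq_sum_card_fiberwise (f := part) (t := Finset.univ.image part)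
    fun x _ => by simp, Finset.card_eq_sum_card_fiberwise (s := T) (f := part)
    (t := Finset.univ.image part) fun x _ => by simp]
  refine Finset.sum_congr rfl fun p hp => ?_
  obtain ⟨v, -, rfl⟩ := Finset.mem_image.1 hp
  rw [hfib, hfib]
  by_cases hv : G.InSimplex v
  · have hP : ∀ u, u ∈ part v ↔ c v = u ∨ G.Adj (c v) u := fun u => by rw [hmem, if_pos hv]
    rw [h.card_simplex hS (hc v hv).2 _ hP, h.card_simplex hT (hc v hv).2 _ hP]
  · have hP : ∀ u, u ∈ part v ↔ G.Reachable v u := fun u => by rw [hmem, if_neg hv]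
    rcases (h.1 v).resolve_left hv with ⟨f, hf, i, rfl⟩ | ⟨f, hf, i, rfl⟩
    · have hP' := fun u => (hP u).trans (hf.reachable_iff heptagon_connected i u)
      rw [hf.card_filter S _ hP', hf.card_filter T _ hP']
      exact heptagon_wellDominated _ _ (hf.isMinimalDominating hS) (hf.isMinimalDominating hT)
    · have hP' := fun u => (hP u).trans (hf.reachable_iff tripod_connected i u)
      rw [hf.card_filter S _ hP', hf.card_filter T _ hP']
      exact tripod_wellDominated _ _ (hf.isMinimalDominating hS) (hf.isMinimalDominating hT)

theorem WellCovered.isSimplexPartitioned [Finite V] (hw : G.WellCovered) (h : G.NoC4C5) :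
    G.IsSimplexPartitioned :=
  ⟨hw.inSimplex_or_inExceptional h.noShortCycle, fun _ _ _ hx hy hxv hyv =>
    hw.simplex_unique hx hy hxv hyv⟩

theorem NoC4C5.wellDominated_iff_wellCovered [Finite V] (h : G.NoC4C5) :
    G.WellDominated ↔ G.WellCovered :=
  ⟨fun hd => hd.wellCovered, fun hw => (hw.isSimplexPartitioned h).wellDominated⟩

theorem NoC4C5.wellDominated_iff_isSimplexPartitioned [Finite V] (h : G.NoC4C5) :
    G.WellDominated ↔ G.IsSimplexPartitioned :=
  ⟨fun hd => hd.wellCovered.isSimplexPartitioned h, fun hp => hp.wellDominated⟩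

end SimpleGraph

/-! ### Structured stack programs and their compilation -/

open Turing

/-- Basic instructions on stacks of symbols `Option Bool` and a register of type `σ`. -/
inductive StackOp (K σ : Type) : Type
  | push (k : K) (f : σ → Option Bool)
  | peek (k : K) (f : σ → Option (Option Bool) → σ)
  | pop (k : K) (f : σ → Option (Option Bool) → σ)
  | load (f : σ → σ)

/-- The contents of the register and of the stacks. -/
structure Store (K σ : Type) : Type where
  var : σ
  stk : K → List (Option Bool)

/-- Structured programs. In `loop l c p`, the instructions `l` are carried out before each test of
the condition `c`. -/
inductive StackProg (K σ : Type) : Type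
  | ops (l : List (StackOp K σ))
  | seq (p q : StackProg K σ)
  | ite (c : σ → Bool) (p q : StackProg K σ)
  | loop (l : List (StackOp K σ)) (c : σ → Bool) (p : StackProg K σ)

section

variable {K σ : Type}

namespace StackOp

variable [DecidableEq K]

/-- The effect of an instruction. -/
def run : StackOp K σ → Store K σ → Store K σ
  | push k f, s => ⟨s.var, Function.update s.stk k (f s.var :: s.stk k)⟩
  | peek k f, s => ⟨f s.var (s.stk k).head?, s.stk⟩
  | pop k f, s => ⟨f s.var (s.stk k).head?, Function.update s.stk k (s.stk k).tail⟩
  | load f, s => ⟨f s.var, s.stk⟩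

/-- The effect of a list of instructions. -/
def runs : List (StackOp K σ) → Store K σ → Store K σ
  | [], s => s
  | o :: l, s => runs l (o.run s)

end StackOp

namespace StackProg

/-- `Exec p s s' t`: the program `p` takes the store `s` to `s'` in `t` steps. -/
inductive Exec [DecidableEq K] : StackProg K σ → Store K σ → Store K σ → ℕ → Prop
  | ops (l s) : Exec (ops l) s (StackOp.runs l s) 1
  | seq {p q s s' s'' t t'} : Exec p s s' t → Exec q s' s'' t' → Exec (seq p q) s s'' (t + t')
  | ite_true {c p q s s' t} : c s.var = true → Exec p s s' t → Exec (ite c p q) s s' (t + 1)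
  | ite_false {c p q s s' t} : c s.var = false → Exec q s s' t → Exec (ite c p q) s s' (t + 1)
  | loop_done {l c p s} : c (StackOp.runs l s).var = false →
      Exec (loop l c p) s (StackOp.runs l s) 1
  | loop_step {l c p s s' s'' t t'} : c (StackOp.runs l s).var = true →
      Exec p (StackOp.runs l s) s' t → Exec (loop l c p) s' s'' t' →
      Exec (loop l c p) s s'' (t + t' + 1)

/-- The alphabets of the machine: the output stack `none` holds booleans. -/
@[reducible]
def Alphabet (K : Type) : Option K → Type
  | none => Bool
  | some _ => Option Bool

/-- A list of instructions followed by a statement. -/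
def opsStmt {L : Type} : List (StackOp K σ) → TM2.Stmt (Alphabet K) L σ →
    TM2.Stmt (Alphabet K) L σ
  | [], q => q
  | .push k f :: l, q => .push (some k) f (opsStmt l q)
  | .peek k f :: l, q => .peek (some k) f (opsStmt l q)
  | .pop k f :: l, q => .pop (some k) f (opsStmt l q)
  | .load f :: l, q => .load f (opsStmt l q)

/-- The labels used by a program. -/
def Lab : StackProg K σ → Type
  | ops _ => Unit
  | seq p q => Lab p ⊕ Lab q
  | ite _ p q => Option (Lab p ⊕ Lab q)
  | loop _ _ p => Option (Lab p)

theorem finite_lab (p : StackProg K σ) : Finite (Lab p) := by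
  induction p with
  | ops => exact inferInstanceAs (Finite Unit)
  | seq p q hp hq => exact inferInstanceAs (Finite (Lab p ⊕ Lab q))
  | ite c p q hp hq => exact inferInstanceAs (Finite (Option (Lab p ⊕ Lab q)))
  | loop l c p hp => exact inferInstanceAs (Finite (Option (Lab p)))

/-- The label at which a program starts. -/
def entry : (p : StackProg K σ) → Lab p
  | ops _ => ()
  | seq p _ => Sum.inl (entry p)
  | ite _ _ _ => (none : Option _)
  | loop _ _ _ => (none : Option _)

/-- The statements of a program whose labels are embedded in `L` by `emb` and that continues at
the label `next`. -/
def code {L : Type} : (p : StackProg K σ) → (Lab p → L) → L → Lab p →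
    TM2.Stmt (Alphabet K) L σ
  | ops l, _, next, _ => opsStmt l (.goto fun _ => next)
  | seq p q, emb, next, l =>
    Sum.casesOn (motive := fun _ => TM2.Stmt (Alphabet K) L σ) (l : Lab p ⊕ Lab q)
      (code p (fun x => emb (Sum.inl x)) (emb (Sum.inr (entry q))))
      (code q (fun x => emb (Sum.inr x)) next)
  | ite c p q, emb, next, l =>
    Option.casesOn (motive := fun _ => TM2.Stmt (Alphabet K) L σ) (l : Option (Lab p ⊕ Lab q))
      (.branch c (.goto fun _ => emb (some (Sum.inl (entry p))))
        (.goto fun _ => emb (some (Sum.inr (entry q)))))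
      fun l => Sum.casesOn (motive := fun _ => TM2.Stmt (Alphabet K) L σ) l
        (code p (fun x => emb (some (Sum.inl x))) next)
        (code q (fun x => emb (some (Sum.inr x))) next)
  | loop k c p, emb, next, l =>
    Option.casesOn (motive := fun _ => TM2.Stmt (Alphabet K) L σ) (l : Option (Lab p))
      (opsStmt k (.branch c (.goto fun _ => emb (some (entry p))) (.goto fun _ => next)))
      (code p (fun x => emb (some x)) (emb (none : Option (Lab p))))

/-- The stacks of the machine. -/
def allStacks (S : K → List (Option Bool)) (o : List Bool) : ∀ k, List (Alphabet K k)
  | none => o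
  | some k => S k

/-- The machine configuration for a label and a store. -/
def config {L : Type} (l : Option L) (s : Store K σ) (o : List Bool) :
    TM2.Cfg (Alphabet K) L σ :=
  ⟨l, s.var, allStacks s.stk o⟩

variable [DecidableEq K]

theorem update_allStacks (S : K → List (Option Bool)) (o : List Bool) (k : K)
    (x : List (Option Bool)) :
    Function.update (allStacks S o) (some k) x = allStacks (Function.update S k x) o := by
  funext j
  cases j with
  | none => rw [Function.update_of_ne (by simp)]; rfl
  | some j =>
    by_cases h : j = k
    · subst h
      rw [Function.update_self]
      exact (Function.update_self j x S).symm
    · rw [Function.update_of_ne (by simpa using h)]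
      exact (Function.update_of_ne h x S).symm

/-- This is why `Exec` charges a single step for a list of instructions: one machine step runs a
statement up to its next jump. -/
theorem stepAux_opsStmt {L : Type} (l : List (StackOp K σ)) (q : TM2.Stmt (Alphabet K) L σ)
    (s : Store K σ) (o : List Bool) :
    TM2.stepAux (opsStmt l q) s.var (allStacks s.stk o) =
      TM2.stepAux q (StackOp.runs l s).var (allStacks (StackOp.runs l s).stk o) := by
  induction l generalizing s with
  | nil => rfl
  | cons op l ih =>
    cases op with
    | push k f =>
      rw [opsStmt, TM2.stepAux, update_allStacks]
      exact ih (StackOp.run (.push k f) s)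
    | peek k f =>
      rw [opsStmt, TM2.stepAux]
      exact ih (StackOp.run (.peek k f) s)
    | pop k f =>
      rw [opsStmt, TM2.stepAux, update_allStacks]
      exact ih (StackOp.run (.pop k f) s)
    | load f =>
      rw [opsStmt, TM2.stepAux]
      exact ih (StackOp.run (.load f) s)

/-- The compiled program carries out the program step by step. -/
theorem Exec.iterate_step {p : StackProg K σ} {s s' : Store K σ} {t : ℕ} (h : Exec p s s' t)
    {L : Type} (M : L → TM2.Stmt (Alphabet K) L σ) (emb : Lab p → L) (next : L)
    (hM : ∀ l, M (emb l) = code p emb next l) (o : List Bool) :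
    (flip bind (TM2.step M))^[t] (some (config (some (emb (entry p))) s o)) =
      some (config (some next) s' o) := by
  have one : ∀ (l : L) (s : Store K σ), flip bind (TM2.step M) (some (config (some l) s o)) =
      some (TM2.stepAux (M l) s.var (allStacks s.stk o)) := fun _ _ => rfl
  induction h generalizing next with
  | ops l s =>
    rw [Function.iterate_one, one, hM, code, stepAux_opsStmt]
    rfl
  | @seq p q s s' s'' t t' _ _ ih1 ih2 =>
    rw [add_comm, Function.iterate_add_apply]
    have h1 := ih1 (fun x => emb (Sum.inl x)) (emb (Sum.inr (entry q))) fun l => hM (Sum.inl l)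
    have h2 := ih2 (fun x => emb (Sum.inr x)) next fun l => hM (Sum.inr l)
    exact (congrArg _ h1).trans h2
  | @ite_true c p q s s' t hc _ ih =>
    rw [Function.iterate_succ_apply, one, hM]
    have h1 := ih (fun x => emb (some (Sum.inl x))) next fun l => hM (some (Sum.inl l))
    refine Eq.trans (congrArg _ ?_) h1
    change some (cond (c s.var) _ _) = _
    rw [hc]
    rfl
  | @ite_false c p q s s' t hc _ ih =>
    rw [Function.iterate_succ_apply, one, hM]
    have h1 := ih (fun x => emb (some (Sum.inr x))) next fun l => hM (some (Sum.inr l))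
    refine Eq.trans (congrArg _ ?_) h1
    change some (cond (c s.var) _ _) = _
    rw [hc]
    rfl
  | @loop_done l c p s hc =>
    rw [Function.iterate_one, one, hM]
    change some (TM2.stepAux (opsStmt l _) _ _) = _
    rw [stepAux_opsStmt]
    change some (cond (c _) _ _) = _
    rw [hc]
    rfl
  | @loop_step l c p s s' s'' t t' hc _ _ ih1 ih2 =>
    rw [Function.iterate_succ_apply, one, hM, add_comm t t', Function.iterate_add_apply]
    have h1 := ih1 (fun x => emb (some x)) (emb (none : Option (Lab p))) fun l => hM (some l)
    have h2 := ih2 emb next hM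
    refine Eq.trans (congrArg _ (Eq.trans (congrArg _ ?_) h1)) h2
    change some (TM2.stepAux (opsStmt l _) _ _) = _
    rw [stepAux_opsStmt]
    change some (cond (c _) _ _) = _
    rw [hc]
    rfl

/-- The machine that runs `p` on the input stack `k₀` and then writes the boolean `res`. -/
noncomputable def machine [Fintype K] [Fintype σ] (p : StackProg K σ) (k₀ : K) (v₀ : σ)
    (res : σ → Bool) : FinTM2 where
  K := Option K
  k₀ := some k₀
  k₁ := none
  Γ := Alphabet K
  Λ := Option (Lab p)
  main := some (entry p)
  ΛFin := @Fintype.ofFinite _ (@instFiniteOption _ (finite_lab p))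
  σ := σ
  initialState := v₀
  Γk₀Fin := inferInstanceAs (Fintype (Option Bool))
  m l := Option.casesOn l (.push none res (.load (fun _ => v₀) .halt)) (code p some none)

/-- A halting configuration must have the initial register and no stack but the output nonempty.
Hence the program has to end with empty stacks, and the final statement, which accounts for the
additional step, resets the register. -/
theorem machine_outputs [Fintype K] [Fintype σ] {p : StackProg K σ} {k₀ : K} {v₀ v : σ}
    {res : σ → Bool} {x : List (Option Bool)} {t m : ℕ}
    (h : Exec p ⟨v₀, Function.update (fun _ => []) k₀ x⟩ ⟨v, fun _ => []⟩ t) (htm : t + 1 ≤ m) :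
    Nonempty (TM2OutputsInTime (machine p k₀ v₀ res) x (some [res v]) m) := by
  refine ⟨⟨⟨t + 1, ?_⟩, htm⟩⟩
  have h1 := h.iterate_step (machine p k₀ v₀ res).m (some : Lab p → Option (Lab p)) none
    (fun _ => rfl) []
  rw [add_comm, Function.iterate_add_apply]
  have h0 : initList (machine p k₀ v₀ res) x =
      config (some (some (entry p))) ⟨v₀, Function.update (fun _ => []) k₀ x⟩ [] := by
    have : ∀ k, (initList (machine p k₀ v₀ res) x).stk k =
        allStacks (Function.update (fun _ => []) k₀ x) [] k := by
      intro k
      cases k with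
      | none => rfl
      | some k =>
        by_cases hk : k = k₀
        · subst hk
          simp only [initList, machine, allStacks, Function.update_self]
          exact dif_pos rfl
        · simp only [initList, machine, allStacks]
          rw [Function.update_of_ne hk]
          exact dif_neg fun e => hk (Option.some.inj e)
    unfold config
    rw [← funext this]
    rfl
  rw [h0]
  refine Eq.trans (congrArg _ h1) ?_
  have h2 : haltList (machine p k₀ v₀ res) [res v] =
      ⟨none, v₀, allStacks (fun _ => []) [res v]⟩ := by
    have : ∀ k, (haltList (machine p k₀ v₀ res) [res v]).stk k =
        allStacks (fun _ => []) [res v] k := by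
      intro k
      cases k with
      | none =>
        simp only [haltList, machine, allStacks]
        exact dif_pos rfl
      | some k =>
        simp only [haltList, machine, allStacks]
        exact dif_neg (Option.some_ne_none k)
    rw [← funext this]
    rfl
  rw [Option.map_some, h2]
  change some (TM2.Cfg.mk none v₀ (Function.update (allStacks (fun _ => []) []) none _)) = _
  congr 2
  funext k
  cases k with
  | none =>
    exact Function.update_self (β := fun k => List (Alphabet K k)) none [res v]
      (allStacks (fun _ => []) [])
  | some k =>
    exact Function.update_of_ne (β := fun k => List (Alphabet K k)) (Option.some_ne_none k) [res v]
      (allStacks (fun _ => []) [])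

end StackProg

end

/-! ### Basic routines of the formula evaluator -/

/-- The stacks of the formula evaluator: the input, an auxiliary stack, and for every variable its
value in unary and a copy of the input, cut into two at the row given by the value. -/
inductive EvalStack (κ : Type) : Type
  | inp
  | aux
  | pos (i : κ)
  | left (i : κ)
  | right (i : κ)
  deriving DecidableEq, Fintype

/-- The register of the formula evaluator: the last truth value, the last symbol read, and a truth
value for every variable. -/
abbrev EvalReg (κ : Type) : Type := Bool × Option (Option Bool) × (κ → Bool)

namespace EvalStack

variable {κ : Type}

/-- The stacks with given contents. -/
def conf (I R : List (Option Bool)) (P X Y : κ → List (Option Bool)) :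
    EvalStack κ → List (Option Bool)
  | inp => I
  | aux => R
  | pos i => P i
  | left i => X i
  | right i => Y i

section simps

variable (I R : List (Option Bool)) (P X Y : κ → List (Option Bool)) (i : κ)
  (l : List (Option Bool))

@[simp] theorem conf_inp : conf I R P X Y inp = I := rfl
@[simp] theorem conf_aux : conf I R P X Y aux = R := rfl
@[simp] theorem conf_pos : conf I R P X Y (pos i) = P i := rfl
@[simp] theorem conf_left : conf I R P X Y (left i) = X i := rfl
@[simp] theorem conf_right : conf I R P X Y (right i) = Y i := rfl

variable [DecidableEq κ]

@[simp] theorem update_aux : Function.update (conf I R P X Y) aux l = conf I l P X Y := by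
  funext k
  cases k <;> simp

@[simp] theorem update_pos : Function.update (conf I R P X Y) (pos i) l =
    conf I R (Function.update P i l) X Y := by
  funext k
  cases k <;> simp [Function.update_apply]

@[simp] theorem update_left : Function.update (conf I R P X Y) (left i) l =
    conf I R P (Function.update X i l) Y := by
  funext k
  cases k <;> simp [Function.update_apply]

@[simp] theorem update_right : Function.update (conf I R P X Y) (right i) l =
    conf I R P X (Function.update Y i l) := by
  funext k
  cases k <;> simp [Function.update_apply]

end simps

end EvalStack

namespace StackProg

open EvalStack StackOp

section steps

variable {K σ : Type} [DecidableEq K]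

theorem Exec.ops_of_eq {l : List (StackOp K σ)} {s s' : Store K σ} (h : runs l s = s') :
    Exec (.ops l) s s' 1 := h ▸ Exec.ops l s

theorem Exec.loop_done_of_eq {l : List (StackOp K σ)} {c : σ → Bool} {p : StackProg K σ}
    {s s' : Store K σ} (h : runs l s = s') (hc : c s'.var = false) : Exec (.loop l c p) s s' 1 := by
  subst h
  exact Exec.loop_done hc

theorem Exec.loop_step_of_eq {l : List (StackOp K σ)} {c : σ → Bool} {p : StackProg K σ}
    {s s₁ s₂ s₃ : Store K σ} {t t' T : ℕ} (h : runs l s = s₁) (hc : c s₁.var = true)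
    (hp : Exec p s₁ s₂ t) (hl : Exec (.loop l c p) s₂ s₃ t') (hT : T = t + t' + 1) :
    Exec (.loop l c p) s s₃ T := by
  subst h hT
  exact Exec.loop_step hc hp hl

end steps

variable {κ : Type}

/-- Pop a symbol into the register. -/
def popSym (k : EvalStack κ) : StackOp (EvalStack κ) (EvalReg κ) :=
  .pop k fun v x => (v.1, x, v.2.2)

/-- Read a symbol into the register. -/
def peekSym (k : EvalStack κ) : StackOp (EvalStack κ) (EvalReg κ) :=
  .peek k fun v x => (v.1, x, v.2.2)

/-- Push the symbol in the register. -/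
def pushSym (k : EvalStack κ) : StackOp (EvalStack κ) (EvalReg κ) :=
  .push k fun v => v.2.1.getD none

/-- Push the end marker. -/
def pushEnd (k : EvalStack κ) : StackOp (EvalStack κ) (EvalReg κ) :=
  .push k fun _ => none

/-- A symbol has been read. -/
def hasSym (v : EvalReg κ) : Bool := v.2.1.isSome

/-- A symbol other than the end marker has been read. -/
def hasBit (v : EvalReg κ) : Bool := (v.2.1.getD none).isSome

variable [DecidableEq κ]

/-- Move the stack `k` to the stacks in `l`, reversing the order. -/
def pour (k : EvalStack κ) (l : List (EvalStack κ)) : StackProg (EvalStack κ) (EvalReg κ) :=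
  .loop [popSym k] hasSym (.ops (l.map pushSym))

/-- Advance in the copy of variable `i` by the value of `j`, and save that value. -/
def walk (i j : κ) : StackProg (EvalStack κ) (EvalReg κ) :=
  .loop [popSym (pos j)] hasSym (.ops [pushEnd aux, popSym (right i), pushSym (left i)])

/-- Undo `walk`. -/
def walkBack (i j : κ) : StackProg (EvalStack κ) (EvalReg κ) :=
  .loop [popSym aux] hasSym (.ops [pushEnd (pos j), popSym (left i), pushSym (right i)])

variable {r : Bool} {c : Option (Option Bool)} {acc : κ → Bool} {I R : List (Option Bool)}
  {P X Y : κ → List (Option Bool)} {i j : κ}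

theorem runs_pushSym (l : List (EvalStack κ)) (hl : l.Nodup) (v : EvalReg κ)
    (S : EvalStack κ → List (Option Bool)) :
    runs (l.map pushSym) ⟨v, S⟩ =
      ⟨v, fun q => if q ∈ l then v.2.1.getD none :: S q else S q⟩ := by
  induction l generalizing S with
  | nil => simp [runs]
  | cons k l ih =>
    rw [List.nodup_cons] at hl
    rw [List.map_cons, runs, pushSym, run, ih hl.2]
    congr 1
    funext q
    by_cases hq : q = k
    · subst hq
      simp [hl.1]
    · simp [hq]

/-- Each symbol costs two steps, the test and the pushes, and the failing last test costs one. -/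
theorem exec_pour {k : EvalStack κ} {l : List (EvalStack κ)} (hl : l.Nodup) (hk : k ∉ l)
    (S : EvalStack κ → List (Option Bool)) :
    Exec (pour k l) ⟨(r, c, acc), S⟩ ⟨(r, none, acc),
      fun q => if q = k then [] else if q ∈ l then (S k).reverse ++ S q else S q⟩
      (2 * (S k).length + 1) := by
  generalize hx : S k = x
  induction x generalizing S c with
  | nil =>
    refine Exec.loop_done_of_eq ?_ rfl
    simp only [runs, run, popSym, hx, List.head?_nil, List.tail_nil, List.reverse_nil,
      List.nil_append, ite_self]
    congr 1
    funext q
    by_cases hq : q = k <;> simp [hq]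
  | cons a x ih =>
    refine Exec.loop_step_of_eq (s₁ := ⟨(r, some a, acc), Function.update S k x⟩) ?_ rfl
      (Exec.ops_of_eq (runs_pushSym l hl _ _))
      (cast ?_ (ih (c := some a)
        (fun q => if q ∈ l then a :: S q else if q = k then x else S q) (by simp [hk])))
      (t' := 2 * x.length + 1) (by simp; ring)
    · simp [runs, run, popSym, hx]
    · congr 2
      · funext q
        by_cases hq : q = k
        · simp [hq, hk]
        · simp [hq]
      · funext q
        by_cases hq : q = k
        · simp [hq]
        · by_cases hl : q ∈ l <;> simp [hq, hl]

/-- The bound on `m` rules out popping from an exhausted copy, in which case a spurious `none` would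
be pushed. -/
theorem exec_walk {m : ℕ} (hP : P j = List.replicate m none) (hY : m ≤ (Y i).length) :
    Exec (walk i j) ⟨(r, c, acc), conf I R P X Y⟩
      ⟨(r, none, acc), conf I (List.replicate m none ++ R) (Function.update P j [])
        (Function.update X i (((Y i).take m).reverse ++ X i))
        (Function.update Y i ((Y i).drop m))⟩ (2 * m + 1) := by
  induction m generalizing c R P X Y with
  | zero =>
    refine Exec.loop_done_of_eq ?_ rfl
    simp [runs, run, popSym, hP]
  | succ m ih =>
    obtain ⟨x, y, hxy⟩ : ∃ x y, Y i = x :: y := by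
      cases h : Y i with
      | nil => simp [h] at hY
      | cons x y => exact ⟨x, y, rfl⟩
    have h : Exec (walk i j) ⟨(r, c, acc), conf I R P X Y⟩ _ (2 * (m + 1) + 1) :=
      Exec.loop_step_of_eq (s₁ := ⟨(r, some none, acc),
        conf I R (Function.update P j (List.replicate m none)) X Y⟩)
      (by simp [runs, run, popSym, hP, List.replicate_succ]) rfl
      (Exec.ops_of_eq (s' := ⟨(r, some x, acc), conf I (none :: R)
        (Function.update P j (List.replicate m none)) (Function.update X i (x :: X i))
        (Function.update Y i y)⟩) (by simp [runs, run, popSym, pushEnd, pushSym, hxy]))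
      (ih (by simp) (by simp [hxy] at hY ⊢; omega)) (by ring)
    simpa [hxy, List.replicate_succ', List.append_assoc] using h

theorem exec_walkBack {m : ℕ} (hX : m ≤ (X i).length) :
    Exec (walkBack i j) ⟨(r, c, acc), conf I (List.replicate m none) P X Y⟩
      ⟨(r, none, acc), conf I [] (Function.update P j (List.replicate m none ++ P j))
        (Function.update X i ((X i).drop m))
        (Function.update Y i (((X i).take m).reverse ++ Y i))⟩ (2 * m + 1) := by
  induction m generalizing c P X Y with
  | zero =>
    refine Exec.loop_done_of_eq ?_ rfl
    simp [runs, run, popSym]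
  | succ m ih =>
    obtain ⟨x, y, hxy⟩ : ∃ x y, X i = x :: y := by
      cases h : X i with
      | nil => simp [h] at hX
      | cons x y => exact ⟨x, y, rfl⟩
    have h : Exec (walkBack i j) ⟨(r, c, acc), conf I (List.replicate (m + 1) none) P X Y⟩ _
        (2 * (m + 1) + 1) :=
      Exec.loop_step_of_eq (s₁ := ⟨(r, some none, acc), conf I (List.replicate m none) P X Y⟩)
      (by simp [runs, run, popSym, List.replicate_succ]) rfl
      (Exec.ops_of_eq (s' := ⟨(r, some x, acc), conf I (List.replicate m none)
        (Function.update P j (none :: P j)) (Function.update X i y)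
        (Function.update Y i (x :: Y i))⟩) (by simp [runs, run, popSym, pushEnd, pushSym, hxy]))
      (ih (by simp [hxy] at hX ⊢; omega)) (by ring)
    simpa [hxy, List.replicate_succ', List.append_assoc] using h

/-- Look up whether the values of `i` and `j` are adjacent. -/
def lookup (i j : κ) : StackProg (EvalStack κ) (EvalReg κ) :=
  .seq (walk i j) (.seq
    (.ops [.peek (right i) fun v x => (x == some (some true), v.2)]) (walkBack i j))

/-- When the copy for `i` is cut at the row of its value, the entry in position `m` of the second
part is the matrix entry sought. An exhausted copy reads as false. -/
theorem exec_lookup {m : ℕ} (hP : P j = List.replicate m none) (hY : m ≤ (Y i).length) :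
    Exec (lookup i j) ⟨(r, c, acc), conf I [] P X Y⟩
      ⟨((Y i)[m]? == some (some true), none, acc), conf I [] P X Y⟩ (4 * m + 3) := by
  have h1 := exec_walk (r := r) (c := c) (acc := acc) (I := I) (R := []) (X := X) hP hY
  rw [List.append_nil] at h1
  have h2 := exec_walkBack (r := (Y i)[m]? == some (some true)) (c := none) (acc := acc) (I := I)
    (P := Function.update P j []) (X := Function.update X i (((Y i).take m).reverse ++ X i))
    (Y := Function.update Y i ((Y i).drop m)) (i := i) (j := j) (m := m)
    (by simp; omega)
  have h3 : Exec (lookup i j) _ _ _ := h1.seq ((Exec.ops_of_eq (by simp [runs, run])).seq h2)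
  convert h3 using 1
  · have h4 : min m (Y i).length = m := by omega
    simp [← hP, h4]
  · ring

/-- Take equal numbers of symbols off the stacks for the values of `i` and `j`. -/
def compareLoop (i j : κ) : StackProg (EvalStack κ) (EvalReg κ) :=
  .loop [peekSym (pos i), .peek (pos j) fun v x => (x.isSome, v.2)] (fun v => v.2.1.isSome && v.1)
    (.ops [popSym (pos i), popSym (pos j), pushEnd aux])

/-- The last test records which stack still has symbols: the symbol read stands for `b < a`, the
truth value for `a < b`. For `i = j` both pops would hit the same stack. -/
theorem exec_compareLoop {a b : ℕ} (hij : i ≠ j) (hi : P i = List.replicate a none)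
    (hj : P j = List.replicate b none) :
    ∃ c' : Option (Option Bool), c'.isSome = decide (b < a) ∧
      Exec (compareLoop i j) ⟨(r, c, acc), conf I R P X Y⟩
        ⟨(decide (a < b), c', acc), conf I (List.replicate (min a b) none ++ R)
          (Function.update (Function.update P i (List.replicate (a - b) none)) j
            (List.replicate (b - a) none)) X Y⟩ (2 * min a b + 1) := by
  induction a generalizing b r c R P with
  | zero =>
    refine ⟨none, by simp, Exec.loop_done_of_eq ?_ (by simp)⟩
    have h : Function.update (Function.update P i []) j (List.replicate b none) = P := by
      rw [← hj, ← List.replicate_zero, ← hi]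
      simp
    simp [runs, run, peekSym, hi, hj, h]
    cases b <;> simp
  | succ a ih =>
    cases b with
    | zero =>
      refine ⟨some none, by simp, Exec.loop_done_of_eq ?_ (by simp)⟩
      have h : Function.update (Function.update P i (List.replicate (a + 1) none)) j [] = P := by
        rw [← hi, ← List.replicate_zero, ← hj]
        simp
      simp only [Nat.min_zero, Nat.sub_zero, Nat.zero_sub, List.replicate_zero, h]
      simp [runs, run, peekSym, hi, hj, List.replicate_succ]
    | succ b =>
      obtain ⟨c', hc', h⟩ := ih (r := true) (c := some none) (R := none :: R) (P := Function.update
        (Function.update P i (List.replicate a none)) j (List.replicate b none)) (b := b)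
        (by simp [hij]) (by simp)
      refine ⟨c', by simpa using hc', ?_⟩
      have h' : Exec (compareLoop i j) ⟨(r, c, acc), conf I R P X Y⟩ _ (2 * (min a b + 1) + 1) :=
        Exec.loop_step_of_eq (s₁ := ⟨(true, some none, acc), conf I R P X Y⟩)
        (by simp [runs, run, peekSym, hi, hj, List.replicate_succ]) rfl
        (Exec.ops_of_eq (by simp [runs, run, popSym, pushEnd, hi, hj, hij.symm,
          List.replicate_succ])) h (by ring)
      convert h' using 1
      · rw [Nat.add_min_add_right, List.replicate_succ', List.append_assoc]
        simp [Function.update_comm hij]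
      · omega

/-- Test whether the values of `i` and `j` are equal. -/
def compare (i j : κ) : StackProg (EvalStack κ) (EvalReg κ) :=
  .seq (compareLoop i j) (.seq (.ops [.load fun v => (!v.2.1.isSome && !v.1, v.2)])
    (pour aux [pos i, pos j]))

theorem exec_compare {a b : ℕ} (hij : i ≠ j) (hi : P i = List.replicate a none)
    (hj : P j = List.replicate b none) :
    Exec (compare i j) ⟨(r, c, acc), conf I [] P X Y⟩
      ⟨(decide (a = b), none, acc), conf I [] P X Y⟩ (4 * min a b + 3) := by
  obtain ⟨c', hc', h⟩ := exec_compareLoop (r := r) (c := c) (acc := acc) (I := I) (R := []) (X := X)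
    (Y := Y) hij hi hj
  have h2 : Exec (compare i j) _ _ _ := h.seq ((Exec.ops_of_eq
    (l := [.load fun v => (!v.2.1.isSome && !v.1, v.2)]) rfl).seq
    (exec_pour (k := aux) (l := [pos i, pos j]) (by simp [hij]) (by simp) _))
  convert h2 using 1
  · congr 1
    · congr 1
      change _ = (!c'.isSome && !decide (a < b))
      rw [hc']
      rcases lt_trichotomy a b with h | h | h
      · simp [h, h.ne]
      · simp [h]
      · simp [h, h.ne']
    · funext q
      cases q with
      | pos k =>
        by_cases h1 : k = i
        · subst h1
          simp [hij, hi]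
          omega
        · by_cases h2 : k = j
          · subst h2
            simp [hj]
            omega
          · simp [h1, h2]
      | _ => simp
  · simp
    ring

/-- Advance the variable `i`. -/
def advance (i : κ) : StackProg (EvalStack κ) (EvalReg κ) :=
  .seq (.loop [popSym (right i)] hasBit (.ops [pushSym (left i)]))
    (.ops [pushEnd (left i), pushEnd (pos i)])

theorem exec_advance {l : List Bool} {y : List (Option Bool)}
    (hY : Y i = l.map some ++ none :: y) :
    Exec (advance i) ⟨(r, c, acc), conf I R P X Y⟩ ⟨(r, some none, acc),
      conf I R (Function.update P i (none :: P i))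
        (Function.update X i ((l.map some ++ [none]).reverse ++ X i))
        (Function.update Y i y)⟩ (2 * l.length + 2) := by
  suffices h : Exec (.loop [popSym (right i)] hasBit (.ops [pushSym (left i)]))
      ⟨(r, c, acc), conf I R P X Y⟩ ⟨(r, some none, acc),
        conf I R P (Function.update X i ((l.map some).reverse ++ X i)) (Function.update Y i y)⟩
      (2 * l.length + 1) by
    exact h.seq (Exec.ops_of_eq (by simp [runs, run, pushEnd]))
  induction l generalizing c X Y with
  | nil =>
    refine Exec.loop_done_of_eq ?_ rfl
    simp [runs, run, popSym, hY]
  | cons b l ih =>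
    have h : Exec (.loop [popSym (right i)] hasBit (.ops [pushSym (left i)]))
        ⟨(r, c, acc), conf I R P X Y⟩ _ (2 * (l.length + 1) + 1) :=
      Exec.loop_step_of_eq (s₁ := ⟨(r, some (some b), acc),
        conf I R P X (Function.update Y i (l.map some ++ none :: y))⟩)
      (by simp [runs, run, popSym, hY]) rfl
      (Exec.ops_of_eq (s' := ⟨(r, some (some b), acc), conf I R P (Function.update X i
        (some b :: X i)) (Function.update Y i (l.map some ++ none :: y))⟩)
        (by simp [runs, run, pushSym]))
      (ih (by simp)) (by ring)
    simpa using h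

/-- Move the variable `i` from the end to the beginning. -/
def rewind (i : κ) : StackProg (EvalStack κ) (EvalReg κ) :=
  .seq (pour (left i) [right i]) (pour (pos i) [])

theorem exec_rewind : Exec (rewind i) ⟨(r, c, acc), conf I R P X Y⟩ ⟨(r, none, acc),
      conf I R (Function.update P i []) (Function.update X i [])
        (Function.update Y i ((X i).reverse ++ Y i))⟩
      (2 * (X i).length + 1 + (2 * (P i).length + 1)) := by
  have h : Exec (rewind i) _ _ _ := (exec_pour (r := r) (c := c) (acc := acc) (k := left i)
    (l := [right i]) (by simp) (by simp) (conf I R P X Y)).seq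
    (exec_pour (r := r) (c := none) (acc := acc) (k := pos i) (l := []) (by simp) (by simp) _)
  convert h using 1
  · congr 1
    funext q
    cases q with
    | pos k => by_cases hk : k = i <;> simp [hk]
    | left k => by_cases hk : k = i <;> simp [hk]
    | right k =>
      by_cases hk : k = i
      · subst hk
        simp
      · simp [hk]
    | _ => simp
  · simp

end StackProg

/-! ### Evaluation of first-order formulas in polynomial time -/

/-- First-order formulas over graphs, with variables from `κ`. -/
inductive Fml (κ : Type) : Type
  | verum
  | adj (i j : κ)
  | eq (i j : κ)
  | neg (φ : Fml κ)
  | and (φ ψ : Fml κ)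
  | ex (i : κ) (φ : Fml κ)

namespace Fml

variable {κ : Type}

/-- The bound variables. -/
def bound : Fml κ → List κ
  | verum => []
  | adj _ _ => []
  | eq _ _ => []
  | neg φ => bound φ
  | and φ ψ => bound φ ++ bound ψ
  | ex i φ => i :: bound φ

/-- No equation `i = i` and no rebinding of a variable. -/
def Nice : Fml κ → Prop
  | verum => True
  | adj _ _ => True
  | eq i j => i ≠ j
  | neg φ => Nice φ
  | and φ ψ => Nice φ ∧ Nice ψ
  | ex i φ => i ∉ bound φ ∧ Nice φ

variable [DecidableEq κ]

/-- The truth value of a formula, with quantification over the numbers less than `n`. -/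
def sat (n : ℕ) (A : ℕ → ℕ → Bool) : Fml κ → (κ → ℕ) → Bool
  | verum, _ => true
  | adj i j, e => A (e i) (e j)
  | eq i j, e => decide (e i = e j)
  | neg φ, e => !sat n A φ e
  | and φ ψ, e => sat n A φ e && sat n A ψ e
  | ex i φ, e => (List.range n).any fun a => sat n A φ (Function.update e i a)

open StackProg EvalStack in
/-- The program that evaluates a formula. -/
def prog : Fml κ → StackProg (EvalStack κ) (EvalReg κ)
  | verum => .ops [.load fun v => (true, v.2)]
  | adj i j => lookup i j
  | eq i j => compare i j
  | neg φ => .seq (prog φ) (.ops [.load fun v => (!v.1, v.2)])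
  | and φ ψ => .seq (prog φ) (.ite (fun v => v.1) (prog ψ) (.ops []))
  | ex i φ => .seq (.ops [.load fun v => (v.1, v.2.1, Function.update v.2.2 i false)]) (.seq
      (.loop [peekSym (right i)] hasSym (.seq (prog φ) (.seq
        (.ops [.load fun v => (v.1, v.2.1, Function.update v.2.2 i (v.2.2 i || v.1))])
        (advance i))))
      (.seq (rewind i) (.ops [.load fun v => (v.2.2 i, v.2)])))

end Fml

/-- A row of a matrix, with an end marker. -/
def matrixRow (n : ℕ) (A : ℕ → ℕ → Bool) (a : ℕ) : List (Option Bool) :=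
  ((List.range n).map (A a)).map some ++ [none]

/-- The rows of a matrix. -/
def matrixRows (n : ℕ) (A : ℕ → ℕ → Bool) : List (List (Option Bool)) :=
  (List.range n).map (matrixRow n A)

theorem length_matrixRow (n : ℕ) (A : ℕ → ℕ → Bool) (a : ℕ) :
    (matrixRow n A a).length = n + 1 := by
  simp [matrixRow]

theorem length_flatten_matrixRows (n : ℕ) (A : ℕ → ℕ → Bool) :
    (matrixRows n A).flatten.length = n * (n + 1) := by
  simp [matrixRows, List.length_flatten, Function.comp_def, length_matrixRow]

theorem flatten_drop_matrixRows {n : ℕ} (A : ℕ → ℕ → Bool) {a : ℕ} (h : a < n) :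
    ((matrixRows n A).drop a).flatten =
      matrixRow n A a ++ ((matrixRows n A).drop (a + 1)).flatten := by
  rw [List.drop_eq_getElem_cons (by simpa [matrixRows] using h)]
  simp [matrixRows]

theorem flatten_take_matrixRows {n : ℕ} (A : ℕ → ℕ → Bool) {a : ℕ} (h : a < n) :
    ((matrixRows n A).take (a + 1)).flatten =
      ((matrixRows n A).take a).flatten ++ matrixRow n A a := by
  rw [List.take_succ_eq_append_getElem (by simpa [matrixRows] using h)]
  simp [matrixRows]

/-- The stacks when the variables have the values `e`. -/
def evalStacks {κ : Type} (n : ℕ) (A : ℕ → ℕ → Bool) (e : κ → ℕ) :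
    EvalStack κ → List (Option Bool) :=
  EvalStack.conf [] [] (fun i => List.replicate (e i) none)
    (fun i => ((matrixRows n A).take (e i)).flatten.reverse)
    (fun i => ((matrixRows n A).drop (e i)).flatten)

open StackProg EvalStack StackOp Polynomial

variable {κ : Type}

theorem evalStacks_congr_update [DecidableEq κ] {n : ℕ} (A : ℕ → ℕ → Bool) (e : κ → ℕ) (i : κ)
    (a : ℕ) : evalStacks n A (Function.update e i a) = conf [] []
      (Function.update (fun k => List.replicate (e k) none) i (List.replicate a none))
      (Function.update (fun k => ((matrixRows n A).take (e k)).flatten.reverse) i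
        ((matrixRows n A).take a).flatten.reverse)
      (Function.update (fun k => ((matrixRows n A).drop (e k)).flatten) i
        ((matrixRows n A).drop a).flatten) := by
  unfold evalStacks
  congr 1 <;> · funext k; by_cases hk : k = i <;> simp [hk]

theorem getElem?_flatten_drop_matrixRows {n : ℕ} (A : ℕ → ℕ → Bool) {a b : ℕ} (ha : a < n)
    (hb : b < n) : ((matrixRows n A).drop a).flatten[b]? = some (some (A a b)) := by
  rw [flatten_drop_matrixRows A ha, List.getElem?_append_left (by rw [length_matrixRow]; omega),
    matrixRow, List.getElem?_append_left (by simpa using hb)]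
  simp [hb]

theorem length_flatten_take_matrixRows_le (n : ℕ) (A : ℕ → ℕ → Bool) (a : ℕ) :
    ((matrixRows n A).take a).flatten.length ≤ n * (n + 1) := by
  rw [← length_flatten_matrixRows n A]
  conv_rhs => rw [← List.take_append_drop a (matrixRows n A), List.flatten_append,
    List.length_append]
  exact Nat.le_add_right _ _

variable [DecidableEq κ] {r : Bool} {c : Option (Option Bool)} {acc : κ → Bool}

/-- Moving on to the next row. -/
theorem exec_advance_evalStacks {n : ℕ} (A : ℕ → ℕ → Bool) (e : κ → ℕ) (i : κ) {a : ℕ}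
    (ha : a < n) (v : EvalReg κ) :
    Exec (advance i) ⟨v, evalStacks n A (Function.update e i a)⟩
      ⟨(v.1, some none, v.2.2), evalStacks n A (Function.update e i (a + 1))⟩ (2 * n + 2) := by
  rw [evalStacks_congr_update, evalStacks_congr_update]
  have h := exec_advance (r := v.1) (c := v.2.1) (acc := v.2.2) (I := []) (R := [])
    (P := Function.update (fun k => List.replicate (e k) none) i (List.replicate a none))
    (X := Function.update (fun k => ((matrixRows n A).take (e k)).flatten.reverse) i
        ((matrixRows n A).take a).flatten.reverse)
    (Y := Function.update (fun k => ((matrixRows n A).drop (e k)).flatten) i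
        ((matrixRows n A).drop a).flatten) (i := i) (l := (List.range n).map (A a))
    (y := ((matrixRows n A).drop (a + 1)).flatten)
    (by rw [Function.update_self, flatten_drop_matrixRows A ha, matrixRow]; simp)
  rw [List.length_map, List.length_range] at h
  convert h using 3
  · rw [Function.update_idem, Function.update_self, ← List.replicate_succ]
  · rw [Function.update_idem, Function.update_self, flatten_take_matrixRows A ha,
      List.reverse_append, matrixRow]
  · rw [Function.update_idem]

theorem exec_rewind_evalStacks {n : ℕ} (A : ℕ → ℕ → Bool) (e : κ → ℕ) {i : κ} (hi : e i = 0)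
    (v : EvalReg κ) :
    ∃ t ≤ 4 * (n * (n + 1)) + 2, Exec (rewind i) ⟨v, evalStacks n A (Function.update e i n)⟩
      ⟨(v.1, none, v.2.2), evalStacks n A e⟩ t := by
  refine ⟨2 * ((matrixRows n A).take n).flatten.length + 1 + (2 * n + 1), ?_, ?_⟩
  · have := length_flatten_take_matrixRows_le n A n
    nlinarith
  · have h := exec_rewind (r := v.1) (c := v.2.1) (acc := v.2.2) (I := []) (R := [])
      (P := Function.update (fun k => List.replicate (e k) none) i (List.replicate n none))
      (X := Function.update (fun k => ((matrixRows n A).take (e k)).flatten.reverse) i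
          ((matrixRows n A).take n).flatten.reverse)
      (Y := Function.update (fun k => ((matrixRows n A).drop (e k)).flatten) i
          ((matrixRows n A).drop n).flatten) (i := i)
    rw [evalStacks_congr_update]
    convert h using 2
    have hn : (matrixRows n A).take n = matrixRows n A :=
      List.take_of_length_le (by simp [matrixRows])
    have hn' : (matrixRows n A).drop n = [] :=
      List.drop_of_length_le (by simp [matrixRows])
    conv_lhs => rw [← Function.update_eq_self i e, hi, evalStacks_congr_update]
    · simp [hn, hn']
    · simp
    · simp

namespace Fml

/-- The program for a formula evaluates it in polynomial time. -/
theorem exec_prog (φ : Fml κ) (hφ : φ.Nice) : ∃ T : ℕ[X], ∀ (n : ℕ) (A : ℕ → ℕ → Bool)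
    (e : κ → ℕ) (v : EvalReg κ), (∀ a b, A a b = true → a < n ∧ b < n) →
    (∀ i, e i = 0 ∨ e i < n) → (∀ i ∈ φ.bound, e i = 0) →
    ∃ v' t, t ≤ T.eval (n * (n + 1)) ∧
      Exec φ.prog ⟨v, evalStacks n A e⟩ ⟨v', evalStacks n A e⟩ t ∧
      v'.1 = φ.sat n A e ∧ ∀ i ∉ φ.bound, v'.2.2 i = v.2.2 i := by
  induction φ with
  | verum => exact ⟨1, fun n A e v _ _ _ => ⟨(true, v.2), 1, by simp, Exec.ops_of_eq rfl, rfl,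
      fun _ _ => rfl⟩⟩
  | adj i j =>
    refine ⟨4 * X + 3, fun n A e v hA he _ => ?_⟩
    -- For `n = 0` all values are 0 and the copies are empty, a case that `exec_lookup` still
    -- covers.
    have hij : e j ≤ ((matrixRows n A).drop (e i)).flatten.length := by
      rcases Nat.eq_zero_or_pos n with h0 | h0
      · have := he j
        omega
      · have hi : e i < n := by have := he i; omega
        rw [flatten_drop_matrixRows A hi, List.length_append, length_matrixRow]
        have := he j
        omega
    refine ⟨_, _, ?_, exec_lookup (r := v.1) (c := v.2.1) (acc := v.2.2) rfl hij, ?_,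
      fun _ _ => rfl⟩
    · have : e j ≤ n * (n + 1) := by rcases he j with h | h <;> nlinarith
      simp
      omega
    · rcases Nat.eq_zero_or_pos n with h0 | h0
      · have hA0 : A (e i) (e j) = false := by
          rw [← Bool.not_eq_true]
          intro h
          have := hA _ _ h
          omega
        subst h0
        simp [sat, hA0, matrixRows]
      · simp only [sat]
        rw [getElem?_flatten_drop_matrixRows A (by have := he i; omega) (by have := he j; omega)]
        cases A (e i) (e j) <;> rfl
  | eq i j =>
    refine ⟨4 * X + 3, fun n A e v hA he _ => ?_⟩
    refine ⟨_, _, ?_, exec_compare (r := v.1) (c := v.2.1) (acc := v.2.2) hφ rfl rfl, rfl,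
      fun _ _ => rfl⟩
    have : e j ≤ n * (n + 1) := by rcases he j with h | h <;> nlinarith
    simp
    omega
  | neg φ ih =>
    obtain ⟨T, hT⟩ := ih hφ
    refine ⟨T + 1, fun n A e v hA he hb => ?_⟩
    obtain ⟨v', t, ht, hx, hv, hr⟩ := hT n A e v hA he hb
    refine ⟨(!v'.1, v'.2), t + 1, by simpa using ht, hx.seq (Exec.ops_of_eq rfl), ?_, hr⟩
    simp [sat, hv]
  | and φ ψ ih1 ih2 =>
    obtain ⟨T₁, h1⟩ := ih1 hφ.1
    obtain ⟨T₂, h2⟩ := ih2 hφ.2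
    refine ⟨T₁ + T₂ + 2, fun n A e v hA he hb => ?_⟩
    obtain ⟨v₁, t₁, ht₁, hx₁, hv₁, hr₁⟩ := h1 n A e v hA he fun i hi => hb i (by simp [bound, hi])
    obtain ⟨v₂, t₂, ht₂, hx₂, hv₂, hr₂⟩ := h2 n A e v₁ hA he fun i hi => hb i (by simp [bound, hi])
    cases h : v₁.1 with
    | true =>
      refine ⟨v₂, t₁ + (t₂ + 1), ?_, hx₁.seq (Exec.ite_true h hx₂), ?_, fun i hi => ?_⟩
      · simp
        omega
      · simp [sat, hv₂, ← hv₁, h]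
      · simp only [bound, List.mem_append, not_or] at hi
        rw [hr₂ i hi.2, hr₁ i hi.1]
    | false =>
      refine ⟨v₁, t₁ + (1 + 1), ?_, hx₁.seq (Exec.ite_false h (Exec.ops_of_eq rfl)), ?_,
        fun i hi => ?_⟩
      · simp
        omega
      · simp [sat, ← hv₁, h]
      · simp only [bound, List.mem_append, not_or] at hi
        exact hr₁ i hi.1
  | ex i φ ih =>
    obtain ⟨T, hT⟩ := ih hφ.2
    refine ⟨X * (T + 2 * X + 4) + 4 * X + 5, fun n A e v hA he hb => ?_⟩
    have hei : e i = 0 := hb i (by simp [bound])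
    -- Here `a` is the current value and `m` the number of rounds left. A round costs the evaluation
    -- of `φ`, one step to update the accumulator of `i`, 2n + 2 to advance and one for the test.
    -- The accumulator survives the evaluation of `φ` because `i` is not rebound there. At the value
    -- `n` the second part of the copy is empty, which ends the loop.
    have loop : ∀ (m a : ℕ) (v : EvalReg κ), a + m = n → ∃ v' t,
        t ≤ m * (T.eval (n * (n + 1)) + 2 * n + 4) + 1 ∧
        Exec (.loop [peekSym (right i)] hasSym (.seq (prog φ) (.seq
          (.ops [.load fun v => (v.1, v.2.1, Function.update v.2.2 i (v.2.2 i || v.1))])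
          (advance i)))) ⟨v, evalStacks n A (Function.update e i a)⟩
          ⟨v', evalStacks n A (Function.update e i n)⟩ t ∧
        v'.2.2 i = (v.2.2 i || (List.range' a m).any fun b => sat n A φ (Function.update e i b)) ∧
        ∀ j ∉ bound (ex i φ), v'.2.2 j = v.2.2 j := by
      intro m
      induction m with
      | zero =>
        intro a v ha
        obtain rfl : a = n := by omega
        refine ⟨(v.1, none, v.2.2), 1, by simp, Exec.loop_done_of_eq ?_ rfl, by simp,
          fun _ _ => rfl⟩
        have hn' : (matrixRows a A).drop a = [] :=
          List.drop_of_length_le (by simp [matrixRows])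
        rw [evalStacks_congr_update]
        simp [runs, run, peekSym, hn']
      | succ m ihm =>
        intro a v ha
        have han : a < n := by omega
        obtain ⟨x, y, hxy⟩ : ∃ x y, ((matrixRows n A).drop a).flatten = x :: y := by
          rw [flatten_drop_matrixRows A han]
          cases h : matrixRow n A a with
          | nil => simpa [h] using length_matrixRow n A a
          | cons x y => exact ⟨x, _, rfl⟩
        obtain ⟨v₁, t₁, ht₁, hx₁, hv₁, hr₁⟩ := hT n A (Function.update e i a)
          (v.1, some x, v.2.2) hA
          (fun j => by
            by_cases hj : j = i
            · subst hj
              simp [han]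
            · simpa [hj] using he j)
          (fun j hj => by
            rw [Function.update_of_ne (by rintro rfl; exact hφ.1 hj)]
            exact hb j (by simp [bound, hj]))
        obtain ⟨v₂, t₂, ht₂, hx₂, hv₂, hr₂⟩ := ihm (a + 1)
          (v₁.1, some none, Function.update v₁.2.2 i (v₁.2.2 i || v₁.1)) (by omega)
        refine ⟨v₂, _, ?_, Exec.loop_step_of_eq ?_ ?_ (hx₁.seq
          ((Exec.ops_of_eq rfl).seq (exec_advance_evalStacks A e i han _))) hx₂ rfl, ?_, ?_⟩
        · rw [add_mul]
          omega
        · rw [evalStacks_congr_update]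
          simp [runs, run, peekSym, hxy]
        · rfl
        · rw [hv₂, List.range'_succ, List.any_cons]
          dsimp only
          rw [Function.update_self, hv₁, hr₁ i hφ.1,
            Bool.or_assoc]
        · intro j hj
          rw [hr₂ j hj]
          simp only [bound, List.mem_cons, not_or] at hj
          dsimp only
          rw [Function.update_of_ne hj.1, hr₁ j hj.2]
    obtain ⟨v₁, t₁, ht₁, hx₁, hv₁, hr₁⟩ := loop n 0 (v.1, v.2.1, Function.update v.2.2 i false)
      (by omega)
    obtain ⟨t₂, ht₂, hx₂⟩ := exec_rewind_evalStacks (n := n) A e hei v₁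
    rw [← hei, Function.update_eq_self] at hx₁
    refine ⟨(v₁.2.2 i, none, v₁.2.2), 1 + (t₁ + (t₂ + 1)), ?_, (Exec.ops_of_eq rfl).seq
      (hx₁.seq (hx₂.seq (Exec.ops_of_eq rfl))), ?_, fun j hj => ?_⟩
    · simp only [eval_add, eval_mul, eval_X, eval_ofNat]
      -- Bounding `n` by `n * (n + 1)` expresses the running time in terms of the input length.
      have : n * (T.eval (n * (n + 1)) + 2 * n + 4) ≤
          n * (n + 1) * (T.eval (n * (n + 1)) + 2 * (n * (n + 1)) + 4) := by
        gcongr <;> nlinarith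
      omega
    · rw [hv₁, sat, List.range_eq_range']
      simp
    · rw [hr₁ j hj]
      simp only [bound, List.mem_cons, not_or] at hj
      exact Function.update_of_ne hj.1 _ _

end Fml

/-- Empty the second parts of the copies for the variables in `l`. -/
def clear (l : List κ) : StackProg (EvalStack κ) (EvalReg κ) :=
  l.foldr (fun i p => .seq (pour (right i) []) p) (.ops [])

theorem exec_clear (l : List κ) (N : ℕ) (v : EvalReg κ) (S : EvalStack κ → List (Option Bool))
    (hS : ∀ i, (S (right i)).length ≤ N) : ∃ v' t, t ≤ l.length * (2 * N + 1) + 1 ∧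
      Exec (clear l) ⟨v, S⟩ ⟨v', fun q => if q ∈ l.map right then [] else S q⟩ t ∧ v'.1 = v.1 := by
  induction l generalizing v S with
  | nil => exact ⟨v, 1, by simp, Exec.ops_of_eq (by simp [runs]), rfl⟩
  | cons i l ih =>
    obtain ⟨v', t, ht, hx, hv⟩ := ih (v.1, none, v.2.2)
      (fun q => if q = right i then [] else S q) (fun j => by
        by_cases hj : j = i <;> simp [hj, hS])
    have h := exec_pour (r := v.1) (c := v.2.1) (acc := v.2.2) (k := right i) (l := []) (by simp)
      (by simp) S
    simp only [List.not_mem_nil, if_false] at h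
    refine ⟨v', 2 * (S (right i)).length + 1 + t, ?_, ?_, hv⟩
    · have := hS i
      rw [List.length_cons, add_mul]
      omega
    · have h' : Exec (clear (i :: l)) _ _ _ := h.seq hx
      convert h' using 2
      funext q
      by_cases hq : q = right i
      · simp [hq]
      · simp [hq]

/-- Copy the input for all variables. -/
noncomputable def distribute [Fintype κ] : StackProg (EvalStack κ) (EvalReg κ) :=
  .seq (pour inp [aux]) (pour aux (Finset.univ.toList.map right))

/-- Pouring reverses the order, so the detour through the auxiliary stack restores it. -/
theorem exec_distribute [Fintype κ] (x : List (Option Bool)) :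
    Exec distribute ⟨(r, c, acc), Function.update (fun _ => []) inp x⟩
      ⟨(r, none, acc), conf [] [] (fun _ => []) (fun _ => []) (fun _ : κ => x)⟩
      (4 * x.length + 2) := by
  have h : Exec (distribute : StackProg (EvalStack κ) (EvalReg κ)) _ _ _ :=
    (exec_pour (r := r) (c := c) (acc := acc) (k := inp) (l := [aux]) (by simp)
    (by simp) (Function.update (fun _ => []) inp x)).seq
    (exec_pour (r := r) (c := none) (acc := acc) (k := aux) (l := Finset.univ.toList.map right)
      ((Finset.nodup_toList _).map fun _ _ h => by simpa using h) (by simp) _)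
  convert h using 1
  · congr 1
    funext q
    cases q <;> simp
  · simp
    ring

/-- The program that copies its input, evaluates `φ` and cleans up. -/
noncomputable def Fml.decider [Fintype κ] (φ : Fml κ) : StackProg (EvalStack κ) (EvalReg κ) :=
  .seq distribute (.seq φ.prog (clear Finset.univ.toList))

open Turing in
/-- Sentences can be evaluated on adjacency matrices in polynomial time. -/
theorem Fml.machine_outputs [Fintype κ] (φ : Fml κ) (hφ : φ.Nice) : ∃ T : ℕ[X],
    ∀ (n : ℕ) (A : ℕ → ℕ → Bool), (∀ a b, A a b = true → a < n ∧ b < n) →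
      Nonempty (TM2OutputsInTime (machine φ.decider inp (false, none, fun _ => false) Prod.fst)
        (matrixRows n A).flatten (some [φ.sat n A fun _ => 0]) (T.eval (n * (n + 1)))) := by
  obtain ⟨T, hT⟩ := φ.exec_prog hφ
  -- The summands pay for copying the input, evaluation, emptying the stacks and writing the answer.
  refine ⟨4 * X + 2 + T + (C (Fintype.card κ) * (2 * X + 1) + 1) + 1, fun n A hA => ?_⟩
  obtain ⟨v₁, t₁, ht₁, hx₁, hv₁, -⟩ := hT n A (fun _ => 0) (false, none, fun _ => false) hA
    (fun _ => Or.inl rfl) (fun _ _ => rfl)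
  obtain ⟨v₂, t₂, ht₂, hx₂, hv₂⟩ := exec_clear Finset.univ.toList (n * (n + 1)) v₁
    (evalStacks n A fun _ : κ => 0) (fun i => by
      simp [evalStacks, ← length_flatten_matrixRows n A])
  have h0 := exec_distribute (r := false) (c := none) (acc := fun _ : κ => false)
    (matrixRows n A).flatten
  have e0 : conf [] [] (fun _ => []) (fun _ => []) (fun _ : κ => (matrixRows n A).flatten) =
      evalStacks n A fun _ => 0 := by
    simp [evalStacks]
  -- All variables are back at 0, so only the second parts of the copies are nonempty.
  have e1 : (fun q => if q ∈ Finset.univ.toList.map right then [] else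
      evalStacks n A (fun _ : κ => 0) q) = fun _ => [] := by
    funext q
    cases q <;> simp [evalStacks]
  rw [e0] at h0
  rw [e1] at hx₂
  rw [← hv₁, ← hv₂]
  refine StackProg.machine_outputs (h0.seq (hx₁.seq hx₂)) ?_
  rw [length_flatten_matrixRows]
  rw [Finset.length_toList, Finset.card_univ] at ht₂
  simp
  omega

/-! ### The structure as a first-order sentence -/

namespace Fml

section Realize

variable {κ : Type} [DecidableEq κ]

/-- The truth of a formula in a graph. -/
def Realize {V : Type*} (G : SimpleGraph V) : Fml κ → (κ → V) → Prop
  | verum, _ => True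
  | adj i j, e => G.Adj (e i) (e j)
  | eq i j, e => e i = e j
  | neg φ, e => ¬ Realize G φ e
  | and φ ψ, e => Realize G φ e ∧ Realize G ψ e
  | ex i φ, e => ∃ a, Realize G φ (Function.update e i a)

attribute [simp] Realize

instance decidableNice : (φ : Fml κ) → Decidable φ.Nice
  | verum => inferInstanceAs (Decidable True)
  | adj _ _ => inferInstanceAs (Decidable True)
  | eq i j => inferInstanceAs (Decidable (i ≠ j))
  | neg φ => decidableNice φ
  | and φ ψ => @instDecidableAnd _ _ (decidableNice φ) (decidableNice ψ)
  | ex i φ => @instDecidableAnd _ _ (inferInstanceAs (Decidable (i ∉ bound φ))) (decidableNice φ)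

/-- Disjunction. -/
def or (φ ψ : Fml κ) : Fml κ := neg (and (neg φ) (neg ψ))

/-- Implication. -/
def imp (φ ψ : Fml κ) : Fml κ := neg (and φ (neg ψ))

/-- Universal quantification. -/
def all (i : κ) (φ : Fml κ) : Fml κ := neg (ex i (neg φ))

/-- Conjunction of a family. -/
def conj {d : ℕ} (φ : Fin d → Fml κ) : Fml κ := ((List.finRange d).map φ).foldr and verum

/-- Disjunction of a family. -/
def disj {d : ℕ} (φ : Fin d → Fml κ) : Fml κ := neg (conj fun i => neg (φ i))

/-- Existential quantification over a family of variables. -/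
def exs {d : ℕ} (x : Fin d → κ) (φ : Fml κ) : Fml κ := ((List.finRange d).map x).foldr ex φ

section

variable {V : Type*} {G : SimpleGraph V} {e : κ → V} {d : ℕ}

@[simp] theorem realize_or {φ ψ : Fml κ} :
    (φ.or ψ).Realize G e ↔ φ.Realize G e ∨ ψ.Realize G e := by
  simp only [or, Realize]
  tauto

@[simp] theorem realize_imp {φ ψ : Fml κ} :
    (φ.imp ψ).Realize G e ↔ (φ.Realize G e → ψ.Realize G e) := by
  simp only [imp, Realize]
  tauto

@[simp] theorem realize_all {φ : Fml κ} {i : κ} :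
    (all i φ).Realize G e ↔ ∀ a, φ.Realize G (Function.update e i a) := by
  simp [all]

@[simp] theorem realize_conj {φ : Fin d → Fml κ} :
    (conj φ).Realize G e ↔ ∀ i, (φ i).Realize G e := by
  have h : ∀ l : List (Fml κ), (l.foldr and verum).Realize G e ↔ ∀ φ ∈ l, φ.Realize G e := by
    intro l
    induction l with
    | nil => simp
    | cons φ l ih => simp [ih]
  simp [conj, h]

@[simp] theorem realize_disj {φ : Fin d → Fml κ} :
    (disj φ).Realize G e ↔ ∃ i, (φ i).Realize G e := by
  simp [disj]

/-- Injectivity of `x` lets the values of the variables be chosen independently as a function on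
`Fin d`. -/
theorem realize_exs {x : Fin d → κ} (hx : Function.Injective x) {φ : Fml κ} :
    (exs x φ).Realize G e ↔ ∃ f : Fin d → V, φ.Realize G (Function.extend x f e) := by
  have h : ∀ (l : List κ) (e : κ → V), (l.foldr ex φ).Realize G e ↔
      ∃ e' : κ → V, (∀ k ∉ l, e' k = e k) ∧ φ.Realize G e' := by
    intro l
    induction l with
    | nil => exact fun e => ⟨fun h => ⟨e, by simp, h⟩, fun ⟨e', h, h'⟩ => by
        rwa [show e = e' from funext fun k => (h k (by simp)).symm]⟩
    | cons i l ih =>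
      intro e
      simp only [List.foldr_cons, Realize, ih]
      constructor
      · rintro ⟨a, e', h, h'⟩
        refine ⟨e', fun k hk => ?_, h'⟩
        rw [List.mem_cons, not_or] at hk
        rw [h k hk.2, Function.update_of_ne hk.1]
      · rintro ⟨e', h, h'⟩
        refine ⟨e' i, e', fun k hk => ?_, h'⟩
        by_cases hki : k = i
        · simp [hki]
        · rw [Function.update_of_ne hki]
          exact h k (by simp [hki, hk])
  rw [exs, h]
  constructor
  · rintro ⟨e', h, h'⟩
    refine ⟨e' ∘ x, ?_⟩
    convert h'
    funext k
    by_cases hk : ∃ i, x i = k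
    · obtain ⟨i, rfl⟩ := hk
      rw [hx.extend_apply]
      rfl
    · rw [Function.extend_apply' _ _ _ hk]
      exact (h k (by simpa using hk)).symm
  · rintro ⟨f, h⟩
    exact ⟨_, fun k hk => Function.extend_apply' _ _ _ (by simpa using hk), h⟩

end

theorem sat_iff_realize {n : ℕ} (G : SimpleGraph (Fin n)) (A : ℕ → ℕ → Bool)
    (hA : ∀ i j : Fin n, A i j = true ↔ G.Adj i j) (φ : Fml κ) (e : κ → Fin n) :
    φ.sat n A (fun k => e k) = true ↔ φ.Realize G e := by
  induction φ generalizing e with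
  | verum => simp [sat]
  | adj i j => simp [sat, hA]
  | eq i j => simp [sat, Fin.ext_iff]
  | neg φ ih => simp [sat, ← ih]
  | and φ ψ ih1 ih2 => simp [sat, ih1, ih2]
  | ex i φ ih =>
    simp only [sat, List.any_eq_true, List.mem_range, Realize, ← ih, Fin.exists_iff]
    have h : ∀ (a : ℕ) (ha : a < n), Function.update (fun k => (e k : ℕ)) i a =
        fun k => (Function.update e i ⟨a, ha⟩ k : ℕ) := by
      intro a ha
      funext k
      by_cases hk : k = i
      · subst hk
        simp
      · simp [hk]
    constructor
    · rintro ⟨a, ha, h'⟩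
      exact ⟨a, ha, by rwa [h a ha] at h'⟩
    · rintro ⟨a, ha, h'⟩
      exact ⟨a, ha, by rwa [h a ha]⟩

end Realize

/-- Variables: ten for the vertices of a component, and five others. -/
abbrev Var : Type := Fin 10 ⊕ Fin 5

/-- The vertex `x` is simplicial; binds `y` and `z`. -/
def simplicial (x y z : Var) : Fml Var :=
  all y (all z (imp (adj x y) (imp (adj x z) (imp (neg (eq y z)) (adj y z)))))

/-- The vertex `y` lies in the closed neighbourhood of `x`. -/
def near (x y : Var) : Fml Var := or (eq x y) (adj x y)

/-- The vertex `v` lies in a connected component isomorphic to `Γ`. -/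
def inCopy {d : ℕ} (hd : d ≤ 10) (Γ : SimpleGraph (Fin d)) [DecidableRel Γ.Adj] (v w : Fin 5) :
    Fml Var :=
  let x : Fin d → Var := fun i => .inl (Fin.castLE hd i)
  exs x (and (conj fun i => conj fun j => if i = j then verum else neg (eq (x i) (x j)))
    (and (conj fun i => conj fun j => if Γ.Adj i j then adj (x i) (x j) else neg (adj (x i) (x j)))
      (and (conj fun i => all (.inr w) (imp (adj (x i) (.inr w)) (disj fun j => eq (x j) (.inr w))))
        (disj fun i => eq (x i) (.inr v)))))

/-- The graph is partitioned into simplexes and exceptional components. -/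
def simplexPartitioned : Fml Var :=
  and
    (all (.inr 0) (or (ex (.inr 1) (and (near (.inr 1) (.inr 0))
        (simplicial (.inr 1) (.inr 2) (.inr 3))))
      (or (inCopy (by decide) SimpleGraph.heptagon 0 1)
        (inCopy le_rfl SimpleGraph.tripod 0 1))))
    (all (.inr 0) (all (.inr 1) (all (.inr 2)
      (imp (simplicial (.inr 1) (.inr 3) (.inr 4)) (imp (simplicial (.inr 2) (.inr 3) (.inr 4))
        (imp (near (.inr 1) (.inr 0)) (imp (near (.inr 2) (.inr 0))
          (near (.inr 1) (.inr 2)))))))))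

theorem nice_simplexPartitioned : simplexPartitioned.Nice := by
  decide +kernel

section

variable {V : Type*} {G : SimpleGraph V} {e : Var → V}

theorem realize_simplicial {x y z : Var} (hxy : x ≠ y) (hxz : x ≠ z) (hyz : y ≠ z) :
    (simplicial x y z).Realize G e ↔ G.IsSimplicial (e x) := by
  simp [simplicial, SimpleGraph.IsSimplicial, hxy, hxz, hyz]

@[simp] theorem realize_near {x y : Var} :
    (near x y).Realize G e ↔ e x = e y ∨ G.Adj (e x) (e y) := by
  simp [near]

theorem realize_inCopy {d : ℕ} (hd : d ≤ 10) (Γ : SimpleGraph (Fin d)) [DecidableRel Γ.Adj]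
    {v w : Fin 5} : (inCopy hd Γ v w).Realize G e ↔
      ∃ f, G.IsClosedCopy Γ f ∧ ∃ i, f i = e (.inr v) := by
  have hx : Function.Injective fun i : Fin d => (Sum.inl (Fin.castLE hd i) : Var) :=
    Sum.inl_injective.comp (Fin.castLE_injective hd)
  have hr : ∀ (f : Fin d → V) (u : Fin 5), Function.extend
      (fun i : Fin d => (Sum.inl (Fin.castLE hd i) : Var)) f e (.inr u) = e (.inr u) :=
    fun f u => Function.extend_apply' _ _ _ (by simp)
  rw [inCopy, realize_exs hx]
  refine exists_congr fun f => ?_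
  have hl : ∀ i : Fin d, Function.extend
      (fun i : Fin d => (Sum.inl (Fin.castLE hd i) : Var)) f e (.inl (Fin.castLE hd i)) = f i :=
    fun i => hx.extend_apply f e i
  have h1 : ∀ i j, (if i = j then verum else neg (eq (.inl (Fin.castLE hd i))
      (.inl (Fin.castLE hd j))) : Fml Var).Realize G (Function.extend
      (fun i : Fin d => (Sum.inl (Fin.castLE hd i) : Var)) f e) ↔ (f i = f j → i = j) := by
    intro i j
    split_ifs with h
    · simp [h]
    · simp [h, hl]
  have h2 : ∀ i j, (if Γ.Adj i j then adj (.inl (Fin.castLE hd i)) (.inl (Fin.castLE hd j)) else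
      neg (adj (.inl (Fin.castLE hd i))
      (.inl (Fin.castLE hd j))) : Fml Var).Realize G (Function.extend
      (fun i : Fin d => (Sum.inl (Fin.castLE hd i) : Var)) f e) ↔
      (G.Adj (f i) (f j) ↔ Γ.Adj i j) := by
    intro i j
    split_ifs with h
    · simp [h, hl]
    · simp [h, hl]
  simp only [Realize, realize_conj, realize_disj, realize_all, realize_imp, h1, h2]
  simp only [hl, hr, ne_eq, reduceCtorEq, not_false_eq_true, Function.update_of_ne,
    Function.update_self]
  exact ⟨fun h => ⟨⟨h.1, h.2.1, h.2.2.1⟩, h.2.2.2⟩,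
    fun h => ⟨h.1.inj, h.1.adj_iff, h.1.closed, h.2⟩⟩

theorem realize_simplexPartitioned :
    simplexPartitioned.Realize G e ↔ G.IsSimplexPartitioned := by
  simp [simplexPartitioned, realize_inCopy, realize_simplicial, SimpleGraph.IsSimplexPartitioned,
    SimpleGraph.InSimplex, SimpleGraph.InExceptional]

end

end Fml

/-! ### Recognition on adjacency matrices -/

open Classical in
/-- The adjacency matrix of a graph, extended by zeros. -/
noncomputable def adjMatrixBool {n : ℕ} (G : SimpleGraph (Fin n)) (a b : ℕ) : Bool :=
  decide (∃ (ha : a < n) (hb : b < n), G.Adj ⟨a, ha⟩ ⟨b, hb⟩)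

theorem adjMatrixBool_iff {n : ℕ} (G : SimpleGraph (Fin n)) (i j : Fin n) :
    adjMatrixBool G i j = true ↔ G.Adj i j := by
  simp [adjMatrixBool]

theorem encodeGraph_eq {n : ℕ} (G : SimpleGraph (Fin n)) :
    encodeGraph G = (matrixRows n (adjMatrixBool G)).flatten := by
  unfold encodeGraph matrixRows matrixRow
  rw [← List.map_coe_finRange_eq_range, List.flatMap_def, List.map_map]
  congr 2
  funext i
  simp [Function.comp_def, adjMatrixBool, -List.map_coe_finRange_eq_range]

/-- For `n = 0` the variables cannot be assigned vertices, so `sat_iff_realize` does not apply; both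
sides then hold vacuously, the sentence being a conjunction of universal statements. -/
theorem sat_simplexPartitioned {n : ℕ} (G : SimpleGraph (Fin n)) :
    Fml.simplexPartitioned.sat n (adjMatrixBool G) (fun _ => 0) = true ↔
      G.IsSimplexPartitioned := by
  rcases n with _ | n
  · refine iff_of_true ?_ ⟨fun v => v.elim0, fun v => v.elim0⟩
    simp [Fml.simplexPartitioned, Fml.all, Fml.sat]
  · exact (Fml.sat_iff_realize G _ (adjMatrixBool_iff G) _ fun _ => 0).trans
      Fml.realize_simplexPartitioned

open Turing StackProg in
-- The sentence does not depend on `n`, so one machine and one polynomial serve all graphs; the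
-- structure theorem makes the truth of the sentence the correct answer.
theorem wellDominatedRecognizableInPolyTime : WellDominatedRecognizableInPolyTime := by
  classical
  obtain ⟨T, hT⟩ := Fml.machine_outputs _ Fml.nice_simplexPartitioned
  have h : ∀ Γ : GraphNoC4C5, Nonempty (TM2OutputsInTime
      (machine (Fml.decider Fml.simplexPartitioned) EvalStack.inp (false, none, fun _ => false)
        Prod.fst) (encodeGraph Γ.1.2) (some [decide Γ.1.2.WellDominated])
      (T.eval (encodeGraph Γ.1.2).length)) := by
    rintro ⟨⟨n, G⟩, hG⟩
    have h1 := hT n (adjMatrixBool G) fun a b h => by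
      obtain ⟨ha, hb, -⟩ := of_decide_eq_true h
      exact ⟨ha, hb⟩
    have h2 : Fml.simplexPartitioned.sat n (adjMatrixBool G) (fun _ => 0) =
        decide G.WellDominated := by
      rw [Bool.eq_iff_iff, sat_simplexPartitioned, decide_eq_true_iff,
        hG.wellDominated_iff_isSimplexPartitioned]
    rw [h2, ← length_flatten_matrixRows n (adjMatrixBool G), ← encodeGraph_eq] at h1
    exact h1
  refine ⟨{
    tm := machine (Fml.decider Fml.simplexPartitioned) EvalStack.inp (false, none, fun _ => false)
      Prod.fst
    inputAlphabet := Equiv.refl (Option Bool)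
    outputAlphabet := Equiv.refl Bool
    time := T
    outputsFun := fun Γ => ?_ }⟩
  have h' := Classical.choice (h Γ)
  have e1 : List.map (Equiv.refl (Option Bool)).invFun (encodeGraph Γ.1.2) = encodeGraph Γ.1.2 :=
    List.map_id _
  exact e1.symm ▸ h'

theorem theorem2p2 :
    (∀ (V : Type*) [Finite V] (G : SimpleGraph V), G.Connected → G.NoC4C5 →
      (G.WellDominated ↔ G.WellCovered)) ∧
    WellDominatedRecognizableInPolyTime :=
  ⟨fun _ _ _ _ hG => hG.wellDominated_iff_wellCovered, wellDominatedRecognizableInPolyTime⟩
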